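/- Let $V$ be a finite set and $H=(V,E)$ a $3$-uniform hypergraph, $n=|V|$. For $v\in V$ let $d_H(v)$ be the number of hyperedges containing $v$, $\delta(H)=\min_v d_H(v)$, and let the link graph $L_v$ be the graph on $V$ with $yz\in E(L_v)$ iff $vyz\in E$. A tight path is a sequence $x_1\dots x_k$ ($k\ge 2$) of distinct vertices with $x_ix_{i+1}x_{i+2}\in E$ for $1\le i\le k-2$; its length is $k-2$, its end-pairs are the starting pair $(x_1,x_2)$ and the ending pair $(x_{k-1},x_k)$, and it is then called a tight $(x_1,x_2)$-$(x_{k-1},x_k)$-path. A tight cycle is a cyclic sequence of $k\ge4$ distinct vertices in which any three cyclically consecutive vertices form a hyperedge. Let $\alpha,\beta>0$ and let $\ell\ge 3$ be an odd integer. For a graph $L$ on $V$ write $e_L(A,B)$ for the number of edges with one vertex in $A$ and one in $B$. Call an induced subgraph $R\subseteq L$ an $(\alpha,\beta,\ell)$-robust subgraph if - $|V(R)|\ge(\frac23+\frac\alpha2)n$, - $e_L(V(R),V\setminus V(R))\le \alpha n^2/4$ and $e(R)\ge(\frac59+\frac\alpha2)\frac{n^2}2-\frac{(n-|V(R)|)^2}2$,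 - for any two distinct vertices $x,y$ of $R$ there are at least $\beta|V(R)|^{\ell-1}$ $x$-$y$-paths of length $\ell$ in $R$. Given such a subgraph $R_v\subseteq L_v$ for every $v\in V$, a pair $xy$ (or $(x,y)$) is $\zeta$-connectable if $xy\in E(R_v)$ for at least $\zeta n$ vertices $v$. For $\theta_*,\zeta_{**},\theta_{**}>0$, a set $\mathcal R\subseteq V$ is a reservoir set if $\frac{\theta_*^2}2n\le|\mathcal R|\le\theta_*^2n$ and for all disjoint $\zeta_{**}$-connectable pairs $(x,y)$, $(z,w)$ there are at least $\theta_{**}|\mathcal R|^{3\ell+1}/2$ tight $(x,y)$-$(z,w)$-paths of length $3(\ell+1)$ in $H$ whose internal vertices (those outside the end-pairs) all lie in $\mathcal R$. For $\zeta_*>0$, a tight path $P_A$ in $H$ with no vertex in $\mathcal R$ is an absorbing path if $|V(P_A)|\le\theta_*n$, its end-pairs are $\zeta_*$-connectable, and for every $X\subseteq V\setminus V(P_A)$ with $|X|\le2\theta_*^2n$ there is a tight path in $H$ with vertex set $V(P_A)\cup X$ and the same end-pairs as $P_A$. **Proposition (Almost spanning cycle).** Let $\alpha,\beta,\zeta_*>0$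 and let $\ell\ge3$ be odd. For every sufficiently small $\theta_*>0$ (depending on $\alpha,\beta,\ell,\zeta_*$), every sufficiently small $\zeta_{**}>0$ (depending on the previous constants), every sufficiently small $\theta_{**}>0$ (depending on the previous constants), and every sufficiently large $n$ (depending on all these constants) the following holds. If $H=(V,E)$ is a $3$-uniform hypergraph on $n$ vertices with $\delta(H)\ge(\frac59+\alpha)\frac{n^2}2$, if $R_v\subseteq L_v$ is an $(\alpha,\beta,\ell)$-robust subgraph for each $v\in V$, if $\mathcal R\subseteq V$ is a reservoir set, and if $P_A$ is an absorbing path in $H-\mathcal R$, then there is a tight cycle $C$ in $H$ that contains $P_A$ as a segment of consecutive vertices and has at least $(1-2\theta_*^2)n$ vertices. -/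

import Mathlib

namespace TightHam

variable {V : Type*}

/-- `H` is a `3`-uniform hypergraph whose vertex set is all of `V`. -/
def IsThreeUniform (H : Hypergraph V) : Prop :=
  H.vertexSet = Set.univ ∧ ∀ e ∈ H.edgeSet, e.ncard = 3

/-- The vertex degree `d_H(v)`: the number of hyperedges containing `v`. -/
noncomputable def degree (H : Hypergraph V) (v : V) : ℕ :=
  {e | e ∈ H.edgeSet ∧ v ∈ e}.ncard

/-- The link graph `L_v`: the graph on `V` in which `yz` is an edge iff `vyz` is a hyperedge. -/
def link (H : Hypergraph V) (v : V) : SimpleGraph V where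
  Adj y z := y ≠ z ∧ ({v, y, z} : Set V) ∈ H.edgeSet
  symm := ⟨fun y z h => ⟨h.1.symm, by rw [Set.pair_comm z y]; exact h.2⟩⟩
  loopless := ⟨fun _ h => h.1 rfl⟩

/-- Any three consecutive vertices of the sequence form a hyperedge. -/
def IsTightWalk (H : Hypergraph V) (l : List V) : Prop :=
  ∀ a b c : V, [a, b, c] <:+: l → ({a, b, c} : Set V) ∈ H.edgeSet

/-- A tight path in `H`, given by the sequence of its vertices. Its length (the number of its
hyperedges) is `l.length - 2`. -/
def IsTightPath (H : Hypergraph V) (l : List V) : Prop :=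
  2 ≤ l.length ∧ l.Nodup ∧ IsTightWalk H l

/-- `l` is a tight `(x, y)`-`(z, w)`-path in `H`: its starting pair is `(x, y)` and its ending pair
is `(z, w)`. -/
def IsTightPathBetween (H : Hypergraph V) (x y z w : V) (l : List V) : Prop :=
  IsTightPath H l ∧ [x, y] <+: l ∧ [z, w] <:+ l

/-- A tight cycle in `H`, given by the sequence `x₁ … x_k` (`k ≥ 4`) of its vertices in cyclic
order: all triples of cyclically consecutive vertices are hyperedges, that is, all triples of
consecutive terms of `x₁ … x_k x₁ x₂`. -/
def IsTightCycle (H : Hypergraph V) (c : List V) : Prop :=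
  4 ≤ c.length ∧ c.Nodup ∧ IsTightWalk H (c ++ c.take 2)

/-- The number of tight `(x, y)`-`(z, w)`-paths in `H` with exactly `k` internal vertices, all of
which belong to `S` (such a path is determined by the sequence `m` of its internal vertices). -/
noncomputable def numTightPaths (H : Hypergraph V) (S : Set V) (k : ℕ) (x y z w : V) : ℕ :=
  {m : List V | m.length = k ∧ (∀ v ∈ m, v ∈ S) ∧
    IsTightPath H ([x, y] ++ m ++ [z, w])}.ncard

/-- A finite graph `G` is `(β, ℓ)`-robust if any two distinct vertices `x`, `y` are joined by at
least `β |V(G)| ^ (ℓ - 1)` paths of length `ℓ`. -/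
def IsRobust {W : Type*} (G : SimpleGraph W) (β : ℝ) (ℓ : ℕ) : Prop :=
  ∀ x y : W, x ≠ y →
    β * (Nat.card W : ℝ) ^ (ℓ - 1) ≤ ({p : G.Walk x y | p.IsPath ∧ p.length = ℓ}.ncard : ℝ)

/-- The number `e_G(A, B)` of edges of `G` with one vertex in `A` and one in `B`. -/
noncomputable def edgesBetween (G : SimpleGraph V) (A B : Set V) : ℕ :=
  {e | e ∈ G.edgeSet ∧ ∃ a ∈ A, ∃ b ∈ B, e = s(a, b)}.ncard

/-- `R` is a robust subgraph of the graph `L` on `V` with parameters `α`, `β`, `ℓ`: an induced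
subgraph that is large, is almost not joined to the remaining vertices, has many edges, and is
`(β, ℓ)`-robust. -/
structure IsRobustSubgraph [Fintype V] {L : SimpleGraph V} (R : L.Subgraph) (α β : ℝ) (ℓ : ℕ) :
    Prop where
  induced : R.IsInduced
  card_verts : (2 / 3 + α / 2) * (Fintype.card V : ℝ) ≤ (R.verts.ncard : ℝ)
  edges_out : (edgesBetween L R.verts R.vertsᶜ : ℝ) ≤ α * (Fintype.card V : ℝ) ^ 2 / 4
  edges_in : (5 / 9 + α / 2) * ((Fintype.card V : ℝ) ^ 2 / 2)
      - ((Fintype.card V : ℝ) - (R.verts.ncard : ℝ)) ^ 2 / 2 ≤ (R.edgeSet.ncard : ℝ)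
  robust : IsRobust R.coe β ℓ

/-- The pair `xy` is `ζ`-connectable with respect to the family of subgraphs `R v ⊆ L_v`: it is an
edge of `R v` for at least `ζ |V|` vertices `v`. -/
def IsConnectable [Fintype V] {H : Hypergraph V} (R : (v : V) → (link H v).Subgraph) (ζ : ℝ)
    (x y : V) : Prop :=
  ζ * (Fintype.card V : ℝ) ≤ ({v : V | (R v).Adj x y}.ncard : ℝ)

/-- `S` is a reservoir set with parameters `ℓ`, `θ₁` (controlling its size), `ζ₂` and `θ₂`: any two
disjoint `ζ₂`-connectable pairs are joined by at least `θ₂ |S| ^ (3ℓ+1) / 2` tight paths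
of length `3(ℓ+1)` (that is, with `3ℓ+1` internal vertices) all of whose internal vertices lie
in `S`. -/
structure IsReservoir [Fintype V] {H : Hypergraph V} (R : (v : V) → (link H v).Subgraph)
    (ℓ : ℕ) (θ₁ ζ₂ θ₂ : ℝ) (S : Finset V) : Prop where
  card_lower : θ₁ ^ 2 / 2 * (Fintype.card V : ℝ) ≤ (S.card : ℝ)
  card_upper : (S.card : ℝ) ≤ θ₁ ^ 2 * (Fintype.card V : ℝ)
  connects : ∀ x y z w : V, IsConnectable R ζ₂ x y → IsConnectable R ζ₂ z w →
    Disjoint ({x, y} : Set V) {z, w} →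
    θ₂ * (S.card : ℝ) ^ (3 * ℓ + 1) / 2 ≤ (numTightPaths H (S : Set V) (3 * ℓ + 1) x y z w : ℝ)

/-- `P` is an absorbing path in `H - S` with parameters `ζ₁`, `θ₁`: a tight path avoiding `S` with
at most `θ₁ n` vertices and `ζ₁`-connectable end-pairs such that for every set `X` of at most
`2 θ₁² n` vertices outside `P` some tight path in `H` with the same end-pairs has vertex
set `V(P) ∪ X`. -/
structure IsAbsorbingPath [Fintype V] {H : Hypergraph V} (R : (v : V) → (link H v).Subgraph)
    (ζ₁ θ₁ : ℝ) (S : Finset V) (P : List V) : Prop where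
  tightPath : IsTightPath H P
  avoids : ∀ v ∈ P, v ∉ S
  card_le : (P.length : ℝ) ≤ θ₁ * (Fintype.card V : ℝ)
  connectable_start : ∀ x y : V, [x, y] <+: P → IsConnectable R ζ₁ x y
  connectable_end : ∀ z w : V, [z, w] <:+ P → IsConnectable R ζ₁ z w
  absorbs : ∀ X : Finset V, (∀ v ∈ X, v ∉ P) → (X.card : ℝ) ≤ 2 * θ₁ ^ 2 * (Fintype.card V : ℝ) →
    ∀ x y z w : V, [x, y] <+: P → [z, w] <:+ P →
      ∃ P' : List V, IsTightPathBetween H x y z w P' ∧ ∀ v : V, v ∈ P' ↔ v ∈ P ∨ v ∈ X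

end TightHam

namespace TightHam

open Finset

universe u

/-! Take a maximum family `𝒞` of disjoint tight paths on `M = 3k + 2` vertices that avoid `S` and
`P` and have connectable end-pairs. The core of the proof (`card_uncovered_le`) is that such a
family misses a set `U` of at most `θ₁² n` vertices outside `S ∪ P`.

Suppose `U` is larger. Cut almost all of the vertices outside `S ∪ P` into blocks of size `M`: the
paths of `𝒞` and pieces of `U`. For linearly many `u ∈ U` almost all edges of `R u` are connectable.
For such `u`, with probability at least `α / 16`, the connectable edges of `R u` between `m` random
blocks contain a matching of more than `m (k + 1)` edges, slightly more than a third of the `m M`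
vertices (`card_samples_with_matching_ge`, resting on the matching bound `lt_card_of_isMaxPacking`,
which is where `5/9` enters). There are boundedly many possible matchings, so one of them recurs. A
blow-up argument as in Erdős's theorem on complete `m`-partite hypergraphs then yields `m (k + 1)`
distinct blocks, in `m` groups of `k + 1`, such that for a positive proportion of the `u` every
choice of one block per group carries that same matching (`exists_common_blowup`).

Each matching edge thus becomes a complete bipartite graph `K_{k+1,k+1}` lying in `R u` for many
common `u`, and the zigzag `a b u a b u … a b` is a tight path on `2 (k + 1) + k = M` vertices
(`exists_zigzag_family`). Choosing `m (k + 1) + 1` matching edges gives that many disjoint new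
paths. They meet only the at most `m (k + 1)` members of `𝒞` that serve as blocks, which contradicts
maximality.

Finally `P` and all paths of `𝒞` are joined into a cycle through the reservoir `S`
(`exists_tightCycle_through`). There are at most `n / k` paths, so for large `k` the connections use
up only a negligible part of `S`. The cycle misses at most `|S| + |U| ≤ 2 θ₁² n` vertices. -/

/-! ### Maximum packings and exchange arguments. -/

/-- `𝒞` consists of good objects with pairwise disjoint supports. -/
structure IsPacking {O W : Type*} (supp : O → Finset W) (good : O → Prop) (𝒞 : Finset O) :
    Prop where
  isGood : ∀ o ∈ 𝒞, good o
  disj : (𝒞 : Set O).PairwiseDisjoint supp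

/-- A packing of maximum cardinality. -/
structure IsMaxPacking {O W : Type*} (supp : O → Finset W) (good : O → Prop) (𝒞 : Finset O) :
    Prop extends IsPacking supp good 𝒞 where
  max : ∀ 𝒟 : Finset O, IsPacking supp good 𝒟 → 𝒟.card ≤ 𝒞.card

theorem IsPacking.card_le {O W : Type*} [Fintype W] [DecidableEq W] {supp : O → Finset W}
    {good : O → Prop} {𝒞 : Finset O} (h : IsPacking supp good 𝒞)
    (hne : ∀ o, good o → (supp o).Nonempty) : 𝒞.card ≤ Fintype.card W := by
  calc 𝒞.card = ∑ _o ∈ 𝒞, 1 := by simp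
    _ ≤ ∑ o ∈ 𝒞, (supp o).card := sum_le_sum fun o ho => (hne o (h.isGood o ho)).card_pos
    _ = (𝒞.biUnion supp).card := (card_biUnion h.disj).symm
    _ ≤ Fintype.card W := card_le_univ _

theorem exists_isMaxPacking {O W : Type*} [Fintype W] (supp : O → Finset W)
    (good : O → Prop) (hne : ∀ o, good o → (supp o).Nonempty) :
    ∃ 𝒞 : Finset O, IsMaxPacking supp good 𝒞 := by
  classical
  set P : ℕ → Prop := fun k => ∃ 𝒟 : Finset O, IsPacking supp good 𝒟 ∧ 𝒟.card = k with hP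
  have h0 : P 0 := ⟨∅, ⟨by simp, by simp⟩, rfl⟩
  obtain ⟨𝒞, h𝒞, hc⟩ : P (Nat.findGreatest P (Fintype.card W)) :=
    Nat.findGreatest_spec (Nat.zero_le _) h0
  refine ⟨𝒞, h𝒞, fun 𝒟 h𝒟 => ?_⟩
  rw [hc]
  exact Nat.le_findGreatest (h𝒟.card_le hne) ⟨𝒟, h𝒟, rfl⟩

/-- In a maximum packing no set of members can be exchanged for a larger one. -/
theorem IsMaxPacking.exchange {O W : Type*} [DecidableEq O] [DecidableEq W]
    {supp : O → Finset W} {good : O → Prop} {𝒞 : Finset O} (h : IsMaxPacking supp good 𝒞)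
    (hne : ∀ o, good o → (supp o).Nonempty) (old new : Finset O) (hold : old ⊆ 𝒞)
    (hnew : IsPacking supp good new)
    (hcross : ∀ o ∈ new, ∀ c ∈ 𝒞 \ old, Disjoint (supp o) (supp c)) :
    new.card ≤ old.card := by
  have hdis : Disjoint (𝒞 \ old) new := by
    rw [disjoint_left]
    intro o h1 h2
    have := hcross o h2 o h1
    rw [disjoint_self_iff_empty] at this
    exact (hne o (hnew.isGood o h2)).ne_empty this
  have hp : IsPacking supp good ((𝒞 \ old) ∪ new) := by
    constructor
    · intro o ho
      rcases mem_union.1 ho with h1 | h1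
      · exact h.isGood o (mem_sdiff.1 h1).1
      · exact hnew.isGood o h1
    · intro a ha b hb hab
      simp only [coe_union, Set.mem_union, mem_coe] at ha hb
      rcases ha with ha | ha <;> rcases hb with hb | hb
      · exact h.disj (mem_sdiff.1 ha).1 (mem_sdiff.1 hb).1 hab
      · exact (hcross b hb a ha).symm
      · exact hcross a ha b hb
      · exact hnew.disj ha hb hab
  have h1 := h.max _ hp
  rw [card_union_of_disjoint hdis, card_sdiff_of_subset hold] at h1
  have := card_le_card hold
  omega

/-! ### Large matchings in dense graphs. -/

/-- The two ends of an ordered pair. -/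
def ends {I : Type*} [DecidableEq I] (p : I × I) : Finset I := {p.1, p.2}

/-- The number of ordered adjacent pairs. -/
noncomputable def adjPairs {I : Type*} [Fintype I] (G : SimpleGraph I) : Finset (I × I) := by
  classical exact univ.filter fun p => G.Adj p.1 p.2

theorem mem_adjPairs {I : Type*} [Fintype I] {G : SimpleGraph I} {p : I × I} :
    p ∈ adjPairs G ↔ G.Adj p.1 p.2 := by
  classical simp [adjPairs]

/-- A Gallai–Edmonds style count by short augmenting paths. Let `W` be the unmatched part of `A`; it
is independent. Call a matching edge rich if one end has at least two neighbours in `W`; then its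
other end has none. These other ends of the `r` rich edges are pairwise non-adjacent, which saves
`r²` pairs inside the matched set. A rich edge sends at most `|W|` edges to `W`, any other edge at
most two. -/
theorem card_adjPairs_le_of_isMaxPacking {I : Type*} [Fintype I] [DecidableEq I]
    (G : SimpleGraph I)
    {𝓜 : Finset (I × I)} (h : IsMaxPacking ends (fun p => G.Adj p.1 p.2) 𝓜) (A : Finset I)
    (hA : ∀ x y, G.Adj x y → x ∈ A) :
    2 * 𝓜.card ≤ A.card ∧ ∃ r ≤ 𝓜.card,
      (adjPairs G).card + r ^ 2 ≤ (2 * 𝓜.card) ^ 2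
        + 2 * (r * (A.card - 2 * 𝓜.card) + 2 * (𝓜.card - r)) := by
  classical
  have hne : ∀ p : I × I, G.Adj p.1 p.2 → (ends p).Nonempty := fun p _ => ⟨p.1, by simp [ends]⟩
  set Mt := 𝓜.biUnion ends with hMt
  have hcard2 : ∀ p ∈ 𝓜, (ends p).card = 2 := fun p hp => card_pair (h.isGood p hp).ne
  have hMtcard : Mt.card = 2 * 𝓜.card := by
    rw [hMt, card_biUnion h.disj, sum_congr rfl hcard2, sum_const, smul_eq_mul, mul_comm]
  have hMtA : Mt ⊆ A := by
    intro x hx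
    obtain ⟨p, hp, hx⟩ := mem_biUnion.1 hx
    simp only [ends, mem_insert, mem_singleton] at hx
    rcases hx with rfl | rfl
    · exact hA _ _ (h.isGood p hp)
    · exact hA _ _ (h.isGood p hp).symm
  refine ⟨hMtcard ▸ card_le_card hMtA, ?_⟩
  set W := A \ Mt with hW
  have hWcard : W.card = A.card - 2 * 𝓜.card := by
    rw [hW, card_sdiff_of_subset hMtA, hMtcard]
  have hWM : ∀ w ∈ W, ∀ p ∈ 𝓜, w ≠ p.1 ∧ w ≠ p.2 := by
    intro w hw p hp
    have h1 := (mem_sdiff.1 hw).2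
    constructor <;> rintro rfl <;> exact h1 (mem_biUnion.2 ⟨p, hp, by simp [ends]⟩)
  have hdisj : ∀ p ∈ 𝓜, ∀ q ∈ 𝓜, p ≠ q →
      p.1 ≠ q.1 ∧ p.1 ≠ q.2 ∧ p.2 ≠ q.1 ∧ p.2 ≠ q.2 := by
    intro p hp q hq hpq
    have h1 : Disjoint (ends p) (ends q) := h.disj hp hq hpq
    simp only [ends, disjoint_left, mem_insert, mem_singleton, not_or] at h1
    have h2 := @h1 p.1 (Or.inl rfl)
    have h3 := @h1 p.2 (Or.inr rfl)
    exact ⟨h2.1, h2.2, h3.1, h3.2⟩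
  set N : I → Finset I := fun x => W.filter fun w => G.Adj x w with hN
  -- no edge inside `W`
  have aug0 : ∀ x ∈ W, ∀ y ∈ W, ¬ G.Adj x y := by
    intro x hx y hy hxy
    have := h.exchange hne ∅ {(x, y)} (by simp) ⟨by simpa using hxy, by simp⟩ ?_
    · simp at this
    · intro o ho c hc
      rw [mem_singleton] at ho
      subst ho
      have hc' := (mem_sdiff.1 hc).1
      have h1 := hWM x hx c hc'
      have h2 := hWM y hy c hc'
      simp only [ends, disjoint_left, mem_insert, mem_singleton, not_or]
      rintro a (rfl | rfl)
      exacts [h1, h2]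
  -- Augmenting path `w a b w'`: the edge `ab` would be exchanged for `aw` and `bw'`.
  have aug1 : ∀ a b, ((a, b) ∈ 𝓜 ∨ (b, a) ∈ 𝓜) → ∀ w ∈ N a, ∀ w' ∈ N b, w = w' := by
    intro a b hab w hw w' hw'
    by_contra hww
    wlog hab' : (a, b) ∈ 𝓜 generalizing a b w w'
    · exact this b a hab.symm w' hw' w hw (Ne.symm hww) (hab.resolve_left hab')
    rw [hN, mem_filter] at hw hw'
    have e1 := hWM w hw.1 _ hab'
    have e2 := hWM w' hw'.1 _ hab'
    have hadj := h.isGood _ hab'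
    have hne2 : ((a, w) : I × I) ≠ (b, w') := fun e => hww (congrArg Prod.snd e)
    have := h.exchange hne {(a, b)} {(a, w), (b, w')} (by simpa using hab') ⟨?_, ?_⟩ ?_
    · rw [card_pair hne2] at this; simp at this
    · simp only [mem_insert, mem_singleton]
      rintro o (rfl | rfl)
      exacts [hw.2, hw'.2]
    · have hb := hadj.ne
      have e3 : b ≠ w := e1.2.symm
      have e4 : w' ≠ a := e2.1
      intro o ho o' ho' hoo
      simp only [coe_insert, coe_singleton, Set.mem_insert_iff, Set.mem_singleton_iff] at ho ho'
      simp only [Function.onFun, ends, disjoint_left, mem_insert, mem_singleton, not_or]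
      rcases ho with rfl | rfl <;> rcases ho' with rfl | rfl <;>
        first
        | exact absurd rfl hoo
        | (rintro x (rfl | rfl) <;> constructor <;> first | assumption | exact Ne.symm ‹_›)
    · intro o ho c hc
      obtain ⟨hc1, hc2⟩ := mem_sdiff.1 hc
      have h1 := hWM w hw.1 c hc1
      have h2 := hWM w' hw'.1 c hc1
      have h3 := hdisj _ hab' c hc1 (fun e => hc2 (by simp [e]))
      simp only [mem_insert, mem_singleton] at ho
      simp only [ends, disjoint_left, mem_insert, mem_singleton, not_or]
      rcases ho with rfl | rfl
      · rintro d (rfl | rfl)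
        exacts [⟨h3.1, h3.2.1⟩, h1]
      · rintro d (rfl | rfl)
        exacts [⟨h3.2.2.1, h3.2.2.2⟩, h2]
  -- Augmenting path `w a b d c w'`: the edges `ab`, `cd` would be exchanged for `aw`, `bd`, `cw'`.
  have aug2 : ∀ p ∈ 𝓜, ∀ q ∈ 𝓜, p ≠ q → ∀ a b c d, (p = (a, b) ∨ p = (b, a)) →
      (q = (c, d) ∨ q = (d, c)) → ∀ w ∈ N a, ∀ w' ∈ N c, w ≠ w' → ¬ G.Adj b d := by
    intro p hp q hq hpq a b c d hab hcd w hw w' hw' hww hbd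
    rw [hN, mem_filter] at hw hw'
    have ep := hWM w hw.1 _ hp
    have eq' := hWM w hw.1 _ hq
    have ep' := hWM w' hw'.1 _ hp
    have eq'' := hWM w' hw'.1 _ hq
    have hpq' := hdisj p hp q hq hpq
    have hpadj := (h.isGood p hp).ne
    have hqadj := (h.isGood q hq).ne
    have key : a ≠ b ∧ c ≠ d ∧ a ≠ c ∧ a ≠ d ∧ b ≠ c ∧ b ≠ d ∧ w ≠ a ∧ w ≠ b ∧ w ≠ c ∧ w ≠ d ∧
        w' ≠ a ∧ w' ≠ b ∧ w' ≠ c ∧ w' ≠ d := by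
      rcases hab with rfl | rfl <;> rcases hcd with rfl | rfl <;> simp only at * <;> grind
    obtain ⟨k1, k2, k3, k4, k5, k6, k7, k8, k9, k10, k11, k12, k13, k14⟩ := key
    have hends : ∀ x y z t : I, ends (x, y) = ends (z, t) → (z = x ∨ z = y) := by
      intro x y z t e
      have : z ∈ ends (x, y) := by rw [e]; simp [ends]
      simpa [ends] using this
    have hcard : ({(a, w), (b, d), (c, w')} : Finset (I × I)).card = 3 := by
      rw [card_eq_three]
      exact ⟨_, _, _, fun e => k1 (congrArg Prod.fst e), fun e => k3 (congrArg Prod.fst e),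
        fun e => k5 (congrArg Prod.fst e), rfl⟩
    have := h.exchange hne {p, q} {(a, w), (b, d), (c, w')} ?_ ⟨?_, ?_⟩ ?_
    · rw [hcard, card_pair hpq] at this; omega
    · intro x hx
      simp only [mem_insert, mem_singleton] at hx
      rcases hx with rfl | rfl <;> assumption
    · simp only [mem_insert, mem_singleton]
      rintro o (rfl | rfl | rfl)
      exacts [hw.2, hbd, hw'.2]
    · intro o ho o' ho' hoo
      simp only [coe_insert, coe_singleton, Set.mem_insert_iff, Set.mem_singleton_iff] at ho ho'
      simp only [Function.onFun, ends, disjoint_left, mem_insert, mem_singleton, not_or]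
      rcases ho with rfl | rfl | rfl <;> rcases ho' with rfl | rfl | rfl <;>
        first
        | exact absurd rfl hoo
        | (rintro x (rfl | rfl) <;> constructor <;> first | assumption | exact Ne.symm ‹_›)
    · intro o ho e he
      obtain ⟨he1, he2⟩ := mem_sdiff.1 he
      have h1 := hWM w hw.1 e he1
      have h2 := hWM w' hw'.1 e he1
      have h3 := hdisj p hp e he1 (fun z => he2 (by simp [z]))
      have h4 := hdisj q hq e he1 (fun z => he2 (by simp [z]))
      have key2 : (a ≠ e.1 ∧ a ≠ e.2) ∧ (b ≠ e.1 ∧ b ≠ e.2) ∧ (c ≠ e.1 ∧ c ≠ e.2) ∧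
          (d ≠ e.1 ∧ d ≠ e.2) := by
        rcases hab with rfl | rfl <;> rcases hcd with rfl | rfl <;> simp only at * <;> grind
      obtain ⟨m1, m2, m3, m4⟩ := key2
      simp only [mem_insert, mem_singleton] at ho
      simp only [ends, disjoint_left, mem_insert, mem_singleton, not_or]
      rcases ho with rfl | rfl | rfl <;> rintro x (rfl | rfl) <;> assumption
  set E := 𝓜.filter fun p => 2 ≤ (N p.1).card ∨ 2 ≤ (N p.2).card with hE
  -- the endpoint of a rich edge without many neighbours in `W`
  set poor : I × I → I := fun p => if 2 ≤ (N p.1).card then p.2 else p.1 with hpoor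
  set rich : I × I → I := fun p => if 2 ≤ (N p.1).card then p.1 else p.2 with hrich
  have hpr : ∀ p ∈ E, (p = (rich p, poor p) ∨ p = (poor p, rich p)) ∧ 2 ≤ (N (rich p)).card := by
    intro p hp
    have := (mem_filter.1 hp).2
    by_cases h2 : 2 ≤ (N p.1).card
    · simp [hrich, hpoor, h2]
    · simp [hrich, hpoor, h2, this.resolve_left h2]
  have hEM : ∀ p ∈ E, p ∈ 𝓜 := fun p hp => (mem_filter.1 hp).1
  have hpoorinj : Set.InjOn poor E := by
    intro p hp q hq e
    by_contra hpq
    have := hdisj p (hEM p hp) q (hEM q hq) hpq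
    have h1 := (hpr p hp).1
    have h2 := (hpr q hq).1
    grind
  have hpp : ∀ p ∈ E, ∀ q ∈ E, ¬ G.Adj (poor p) (poor q) := by
    intro p hp q hq
    by_cases hpq : p = q
    · subst hpq; exact G.irrefl
    obtain ⟨h1, h1'⟩ := hpr p hp
    obtain ⟨h2, h2'⟩ := hpr q hq
    obtain ⟨w, hw⟩ : (N (rich p)).Nonempty := card_pos.1 (by omega)
    obtain ⟨w', hw', hww⟩ := exists_mem_ne (by omega : 1 < (N (rich q)).card) w
    exact aug2 p (hEM p hp) q (hEM q hq) hpq _ _ _ _ h1 h2 w hw w' hw' hww.symm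
  have hEle : E.card ≤ 𝓜.card := card_filter_le _ _
  refine ⟨E.card, hEle, ?_⟩
  -- counting
  have c1 : (G.interedges Mt Mt).card + E.card ^ 2 ≤ (2 * 𝓜.card) ^ 2 := by
    have hPs : (E.image poor) ×ˢ (E.image poor) ⊆ Mt ×ˢ Mt := by
      have : E.image poor ⊆ Mt := by
        intro x hx
        obtain ⟨p, hp, rfl⟩ := mem_image.1 hx
        refine mem_biUnion.2 ⟨p, hEM p hp, ?_⟩
        simp only [hpoor, ends]; split_ifs <;> simp
      exact product_subset_product this this
    have hd : Disjoint (G.interedges Mt Mt) ((E.image poor) ×ˢ (E.image poor)) := by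
      rw [disjoint_left]
      rintro ⟨x, y⟩ h1 h2
      rw [SimpleGraph.mk_mem_interedges_iff] at h1
      obtain ⟨hx, hy⟩ := mem_product.1 h2
      obtain ⟨p, hp, e1⟩ := mem_image.1 hx
      obtain ⟨q, hq, e2⟩ := mem_image.1 hy
      simp only at e1 e2
      subst e1 e2
      exact hpp p hp q hq h1.2.2
    have hs : G.interedges Mt Mt ⊆ Mt ×ˢ Mt := filter_subset _ _
    have := card_le_card (union_subset hs hPs)
    rw [card_union_of_disjoint hd, card_product, card_product, card_image_of_injOn hpoorinj,
      hMtcard] at this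
    nlinarith
  have c2 : (G.interedges Mt W).card ≤ E.card * W.card + 2 * (𝓜.card - E.card) := by
    have e1 : (G.interedges Mt W).card = ∑ x ∈ Mt, (N x).card := by
      rw [SimpleGraph.interedges_def, card_filter, sum_product]
      refine sum_congr rfl fun x _ => ?_
      rw [hN, card_filter]
    rw [e1, hMt, sum_biUnion h.disj]
    have e2 : ∀ p ∈ 𝓜, ∑ x ∈ ends p, (N x).card = (N p.1).card + (N p.2).card := fun p hp =>
      sum_pair (h.isGood p hp).ne
    rw [sum_congr rfl e2, ← sum_filter_add_sum_filter_not 𝓜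
      (fun p => 2 ≤ (N p.1).card ∨ 2 ≤ (N p.2).card)]
    refine add_le_add ?_ ?_
    · refine sum_le_card_nsmul _ _ _ ?_
      intro p hp
      have hpM := hEM p hp
      have hle : ∀ x, (N x).card ≤ W.card := fun x => card_filter_le _ _
      rcases (mem_filter.1 hp).2 with h2 | h2
      · have : N p.2 = ∅ := by
          rw [eq_empty_iff_forall_notMem]
          intro w hw
          obtain ⟨w', hw', hne'⟩ := exists_mem_ne (by omega : 1 < (N p.1).card) w
          exact hne' (aug1 p.1 p.2 (Or.inl hpM) w' hw' w hw)
        simp [this, hle]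
      · have : N p.1 = ∅ := by
          rw [eq_empty_iff_forall_notMem]
          intro w hw
          obtain ⟨w', hw', hne'⟩ := exists_mem_ne (by omega : 1 < (N p.2).card) w
          exact hne' (aug1 p.2 p.1 (Or.inr hpM) w' hw' w hw)
        simp [this, hle]
    · have hcardnot : (𝓜.filter fun p => ¬ (2 ≤ (N p.1).card ∨ 2 ≤ (N p.2).card)).card
          = 𝓜.card - E.card := by
        have : E.card + (𝓜.filter fun p => ¬ (2 ≤ (N p.1).card ∨ 2 ≤ (N p.2).card)).card
            = 𝓜.card := card_filter_add_card_filter_not _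
        omega
      rw [← hcardnot, mul_comm]
      refine sum_le_card_nsmul _ _ _ ?_
      intro p hp
      have := (mem_filter.1 hp).2
      omega
  have c3 : adjPairs G ⊆ G.interedges Mt Mt ∪ (G.interedges Mt W ∪ G.interedges W Mt) := by
    rintro ⟨x, y⟩ hxy
    rw [mem_adjPairs] at hxy
    have hx := hA x y hxy
    have hy := hA y x hxy.symm
    simp only [mem_union, SimpleGraph.mk_mem_interedges_iff, hW, mem_sdiff, hx, hy, hxy, true_and,
      and_true]
    by_cases h1 : x ∈ Mt <;> by_cases h2 : y ∈ Mt <;> simp [h1, h2]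
    exact aug0 x (mem_sdiff.2 ⟨hx, h1⟩) y (mem_sdiff.2 ⟨hy, h2⟩) hxy
  have c4 := (card_le_card c3).trans ((card_union_le _ _).trans
    (Nat.add_le_add_left (card_union_le _ _) _))
  have c5 : (G.interedges W Mt).card = (G.interedges Mt W).card := by
    have := G.symm
    exact Rel.card_interedges_comm W Mt
  rw [c5] at c4
  rw [hWcard] at c2
  omega

/-- With `Q` vertices, `N = |A|` and a matching of size about `Q / 3`, the preceding bound is at
most `4Q²/9 + (N - 2Q/3)²` up to lower-order terms, after maximizing over `r`. By convexity this is
at most `5Q²/9 - (Q - N)²` for `2Q/3 ≤ N ≤ Q`, with equality at both ends of the range: hence the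
density `5/9`. The surplus `ε Q²` pays for the additional `m / 3` edges and the linear terms. -/
theorem lt_card_of_isMaxPacking {I : Type*} [Fintype I] [DecidableEq I]
    (G : SimpleGraph I)
    {𝓜 : Finset (I × I)} (h : IsMaxPacking ends (fun p => G.Adj p.1 p.2) 𝓜) (A : Finset I)
    (hA : ∀ x y, G.Adj x y → x ∈ A) {ε m : ℝ} (hm : 0 ≤ m)
    (hQ : 6 < ε * Fintype.card I) (hmQ : 4 * m ≤ ε * Fintype.card I)
    (hmQ' : m ≤ Fintype.card I)
    (hN : 2 / 3 * (Fintype.card I : ℝ) ≤ A.card)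
    (hD : (5 / 9 + ε) * (Fintype.card I : ℝ) ^ 2 - ((Fintype.card I : ℝ) - A.card) ^ 2
      ≤ (adjPairs G).card) :
    (Fintype.card I + m) / 3 < 𝓜.card := by
  obtain ⟨h2s, r, hr, hle⟩ := card_adjPairs_le_of_isMaxPacking G h A hA
  have hNQ : (A.card : ℝ) ≤ Fintype.card I := by exact_mod_cast card_le_univ A
  have hle' : ((adjPairs G).card : ℝ) + (r : ℝ) ^ 2 ≤ (2 * 𝓜.card) ^ 2
        + 2 * (r * (A.card - 2 * 𝓜.card) + 2 * (𝓜.card - r)) := by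
    have := (Nat.cast_le (α := ℝ)).2 hle
    push_cast [Nat.cast_sub h2s, Nat.cast_sub hr] at this
    exact this
  have hr' : (r : ℝ) ≤ 𝓜.card := by exact_mod_cast hr
  have hr0 : (0 : ℝ) ≤ r := by positivity
  have h2s' : 2 * (𝓜.card : ℝ) ≤ A.card := by exact_mod_cast h2s
  generalize (A.card : ℝ) = N at *
  generalize (Fintype.card I : ℝ) = Q at *
  generalize ((adjPairs G).card : ℝ) = D at *
  generalize (𝓜.card : ℝ) = s at *
  generalize (r : ℝ) = t at *
  by_contra! hs
  have hQ0 : 0 ≤ Q := hm.trans hmQ'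
  set s0 := (Q + m) / 3 with hs0
  -- The bound is monotone in the matching size because `t ≤ s`, so `s` may be replaced by `s0`.
  have a1 : 4 * s ^ 2 - 4 * t * s ≤ 4 * s0 ^ 2 - 4 * t * s0 := by
    nlinarith [mul_nonneg (sub_nonneg.2 hs) (by linarith : 0 ≤ s0 + s - t)]
  -- The quadratic in `t` is maximal at `t = N - 2Q/3`.
  have a2 : -t ^ 2 + 2 * t * (N - 2 / 3 * Q) ≤ (N - 2 / 3 * Q) ^ 2 := by
    nlinarith [sq_nonneg (t - (N - 2 / 3 * Q))]
  have a3 : (N - 2 / 3 * Q) ^ 2 + 4 / 9 * Q ^ 2 ≤ 5 / 9 * Q ^ 2 - (Q - N) ^ 2 := by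
    nlinarith [mul_nonneg (sub_nonneg.2 hN) (sub_nonneg.2 hNQ)]
  have a4 : t * s0 ≥ t * (Q / 3) := by
    apply mul_le_mul_of_nonneg_left _ hr0
    rw [hs0]; linarith
  have a5 : 4 * s0 ^ 2 = 4 / 9 * Q ^ 2 + 8 / 9 * Q * m + 4 / 9 * m ^ 2 := by
    rw [hs0]; ring
  have a6 : m ^ 2 ≤ Q * m := by nlinarith
  have a7 : 4 * m * Q ≤ ε * Q * Q := mul_le_mul_of_nonneg_right hmQ hQ0
  have hQpos : 0 < Q := by
    rcases hQ0.lt_or_eq with h | h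
    · exact h
    · rw [← h] at hQ; simp at hQ; linarith
  have a8 : 6 * Q < ε * Q * Q := mul_lt_mul_of_pos_right hQ hQpos
  nlinarith

/-! ### Random samples of blocks. -/

theorem sum_apply_eq {ι X : Type*} [Fintype ι] [DecidableEq ι] [Fintype X] (i : ι) (f : X → ℝ) :
    ∑ s : ι → X, f (s i) = (Fintype.card X : ℝ) ^ (Fintype.card ι - 1) * ∑ x, f x := by
  rw [← (Equiv.funSplitAt i X).symm.sum_comp, Fintype.sum_prod_type]
  have : ∀ x (y : {j // j ≠ i} → X), f ((Equiv.funSplitAt i X).symm (x, y) i) = f x := by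
    intro x y; simp [Equiv.funSplitAt, Equiv.piSplitAt]
  simp only [this, sum_const, card_univ, nsmul_eq_mul, Fintype.card_fun, ← mul_sum]
  congr 1
  push_cast
  congr 1
  simp [Fintype.card_subtype_compl]

theorem sum_apply_apply_eq {ι X : Type*} [Fintype ι] [DecidableEq ι] [Fintype X] {i j : ι}
    (hij : i ≠ j) (f : X → X → ℝ) :
    ∑ s : ι → X, f (s i) (s j)
      = (Fintype.card X : ℝ) ^ (Fintype.card ι - 2) * ∑ x, ∑ y, f x y := by
  rw [← (Equiv.funSplitAt i X).symm.sum_comp, Fintype.sum_prod_type]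
  have : ∀ x (y : {j // j ≠ i} → X), f ((Equiv.funSplitAt i X).symm (x, y) i)
      ((Equiv.funSplitAt i X).symm (x, y) j) = f x (y ⟨j, hij.symm⟩) := by
    intro x y; simp [Equiv.funSplitAt, Equiv.piSplitAt, hij.symm]
  simp only [this, sum_apply_eq, ← mul_sum]
  congr 2
  simp [Fintype.card_subtype_compl]
  omega

/-- Second-moment sampling: for a positive proportion of the samples `s` of `m` points of `X`, the
pair weight `w` is almost as large as on average and the weight `g` is close to its mean. -/
theorem card_filter_sample_ge {X : Type*} [Fintype X] (hX : 0 < Fintype.card X)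
    (w : X → X → ℝ) (g : X → ℝ) (hw0 : ∀ x y, 0 ≤ w x y) (hw1 : ∀ x y, w x y ≤ 1)
    (hg0 : ∀ x, 0 ≤ g x) (hg1 : ∀ x, g x ≤ 1) {a μ τ c K : ℝ} (hK : 0 ≤ K)
    (hτ : 0 ≤ τ)
    (ha : a * (Fintype.card X : ℝ) ^ 2 ≤ ∑ x, ∑ y, w x y)
    (hμ : ∑ x, g x = μ * Fintype.card X) {m : ℕ} (hm : 2 ≤ m)
    (hm' : (τ + c) * m ^ 2 ≤ a * (m * (m - 1)) - K * m) :
    c * (Fintype.card X : ℝ) ^ m ≤ (univ.filter fun s : Fin m → X =>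
      τ * m ^ 2 ≤ ∑ i, ∑ j ∈ univ.erase i, w (s i) (s j) ∧
      K * (∑ i, g (s i) - m * μ) ^ 2 ≤ m ^ 2).card := by
  classical
  set q : ℝ := (Fintype.card X : ℝ) with hq
  have hq0 : 0 < q := Nat.cast_pos.2 hX
  set A : (Fin m → X) → ℝ := fun s => ∑ i, ∑ j ∈ univ.erase i, w (s i) (s j) with hA
  set B : (Fin m → X) → ℝ := fun s => (∑ i, g (s i) - m * μ) ^ 2 with hB
  have hm0 : (0 : ℝ) < m := by positivity
  have hA1 : ∀ s, A s ≤ m ^ 2 := by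
    intro s
    calc A s ≤ ∑ i : Fin m, ∑ j : Fin m, (1 : ℝ) := by
          refine sum_le_sum fun i _ => ?_
          refine (sum_le_sum_of_subset_of_nonneg (erase_subset _ _) fun _ _ _ => hw0 _ _).trans ?_
          exact sum_le_sum fun j _ => hw1 _ _
      _ = m ^ 2 := by simp; ring
  have hB0 : ∀ s, 0 ≤ B s := fun s => sq_nonneg _
  have hsumA : a * (m * (m - 1)) * q ^ m ≤ ∑ s, A s := by
    have : ∑ s, A s = m * (m - 1) * (q ^ (m - 2) * ∑ x, ∑ y, w x y) := by
      simp only [hA]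
      rw [sum_comm]
      have : ∀ i : Fin m, ∑ s : Fin m → X, ∑ j ∈ univ.erase i, w (s i) (s j)
          = (m - 1) * (q ^ (m - 2) * ∑ x, ∑ y, w x y) := by
        intro i
        rw [sum_comm]
        have h : ∀ j ∈ univ.erase i, ∑ s : Fin m → X, w (s i) (s j)
            = q ^ (m - 2) * ∑ x, ∑ y, w x y := by
          intro j hj
          rw [sum_apply_apply_eq (ne_of_mem_erase hj).symm w, Fintype.card_fin]
        rw [sum_congr rfl h, sum_const, card_erase_of_mem (mem_univ _), card_univ,
          Fintype.card_fin, nsmul_eq_mul, Nat.cast_sub (by omega), Nat.cast_one]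
      simp only [this, sum_const, card_univ, Fintype.card_fin, nsmul_eq_mul]
      ring
    rw [this]
    have h1 : q ^ m = q ^ (m - 2) * q ^ 2 := by rw [← pow_add]; congr 1; omega
    have h2 : (0 : ℝ) ≤ m * (m - 1) * q ^ (m - 2) := by
      have : (1 : ℝ) ≤ m := by exact_mod_cast (by omega : 1 ≤ m)
      have := sub_nonneg.2 this
      positivity
    calc a * (m * (m - 1)) * q ^ m = (m * (m - 1) * q ^ (m - 2)) * (a * q ^ 2) := by rw [h1]; ring
      _ ≤ (m * (m - 1) * q ^ (m - 2)) * ∑ x, ∑ y, w x y := mul_le_mul_of_nonneg_left ha h2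
      _ = _ := by ring
  -- The variance of a sum of independent variables: after centring, all off-diagonal terms vanish.
  have hsumB : ∑ s, B s ≤ m * q ^ m := by
    have hzero : ∑ x, (g x - μ) = 0 := by
      rw [sum_sub_distrib, hμ, sum_const, card_univ, nsmul_eq_mul]; ring
    have hvar : ∑ x, (g x - μ) * (g x - μ) ≤ q := by
      have hμ0 : 0 ≤ μ := by
        have : 0 ≤ μ * q := hμ ▸ sum_nonneg fun x _ => hg0 x
        exact nonneg_of_mul_nonneg_left this hq0
      have hμ1 : μ ≤ 1 := by
        have : μ * q ≤ 1 * q := by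
          rw [← hμ, one_mul, hq, Fintype.card_eq_sum_ones]
          push_cast
          exact sum_le_sum fun x _ => hg1 x
        exact le_of_mul_le_mul_right this hq0
      calc ∑ x, (g x - μ) * (g x - μ) ≤ ∑ _x : X, (1 : ℝ) := by
            refine sum_le_sum fun x _ => ?_
            have := hg0 x; have := hg1 x
            nlinarith
        _ = q := by simp [hq]
    have hexp : ∀ s, B s = ∑ i, ∑ j, (g (s i) - μ) * (g (s j) - μ) := by
      intro s
      rw [← sum_mul_sum, ← sq]
      simp [hB, sum_sub_distrib]
    simp only [hexp]
    rw [sum_comm]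
    have : ∀ i : Fin m, ∑ s : Fin m → X, ∑ j, (g (s i) - μ) * (g (s j) - μ)
        ≤ q ^ m := by
      intro i
      rw [sum_comm, ← add_sum_erase _ _ (mem_univ i)]
      have h0 : ∀ j ∈ univ.erase i, ∑ s : Fin m → X, (g (s i) - μ) * (g (s j) - μ) = 0 := by
        intro j hj
        rw [sum_apply_apply_eq (ne_of_mem_erase hj).symm (fun x y => (g x - μ) * (g y - μ))]
        simp [← mul_sum, hzero]
      rw [sum_eq_zero h0, add_zero,
        sum_apply_eq i (fun x => (g x - μ) * (g x - μ)), Fintype.card_fin]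
      calc q ^ (m - 1) * ∑ x, (g x - μ) * (g x - μ) ≤ q ^ (m - 1) * q :=
            mul_le_mul_of_nonneg_left hvar (by positivity)
        _ = q ^ m := by rw [← pow_succ]; congr 1; omega
    refine (sum_le_sum fun i _ => this i).trans ?_
    simp
  set F := univ.filter fun s : Fin m → X => τ * m ^ 2 ≤ A s ∧ K * B s ≤ m ^ 2 with hF
  -- Pointwise `A s - K * B s` is at most `τ m²` outside `F` and at most `m²` on `F`. Comparing with
  -- the mean, which is at least `(τ + c) m²`, bounds the size of `F` from below.
  have hup : ∑ s, (A s - K * B s) ≤ τ * m ^ 2 * q ^ m + m ^ 2 * F.card := by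
    calc ∑ s, (A s - K * B s) ≤ ∑ s, (τ * m ^ 2 + if s ∈ F then (m : ℝ) ^ 2 else 0) := by
          refine sum_le_sum fun s _ => ?_
          have h1 := hA1 s
          have h2 := mul_nonneg hK (hB0 s)
          have h3 : 0 ≤ τ * (m : ℝ) ^ 2 := by positivity
          split_ifs with h
          · linarith
          · simp only [hF, mem_filter, mem_univ, true_and, not_and_or, not_le] at h
            rcases h with h | h <;> linarith
      _ = _ := by
          rw [sum_add_distrib, sum_const, card_univ, Fintype.card_fun, Fintype.card_fin,
            nsmul_eq_mul, ← sum_filter, sum_const, nsmul_eq_mul]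
          simp only [filter_mem_eq_inter, univ_inter]
          push_cast
          ring
  have hlow : (τ + c) * m ^ 2 * q ^ m ≤ ∑ s, (A s - K * B s) := by
    rw [sum_sub_distrib, ← mul_sum]
    have h1 := mul_le_mul_of_nonneg_left hsumB hK
    have h2 := mul_le_mul_of_nonneg_right hm' (by positivity : 0 ≤ q ^ m)
    nlinarith
  have : m ^ 2 * (c * q ^ m) ≤ m ^ 2 * (F.card : ℝ) := by nlinarith
  exact le_of_mul_le_mul_left this (by positivity)

/-- The graph on `Fin m × Fin M` induced by `G` on the blocks `β (s 0, ·), …, β (s (m - 1), ·)`,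
without the edges inside the blocks. -/
def sampleGraph {V X : Type*} {m M : ℕ} (G : SimpleGraph V) (β : X × Fin M → V)
    (s : Fin m → X) : SimpleGraph (Fin m × Fin M) where
  Adj p q := p.1 ≠ q.1 ∧ G.Adj (β (s p.1, p.2)) (β (s q.1, q.2))
  symm := ⟨fun _ _ h => ⟨h.1.symm, h.2.symm⟩⟩
  loopless := ⟨fun _ h => h.1 rfl⟩

/-- Termwise: `φ` is dominated by the indicator of adjacency plus the indicator that both ends lie
outside `A`. Over the whole sample the latter sums to the square of the number of sampled points
outside `A`. -/
theorem adjPairs_sampleGraph_ge {V X : Type*} {m M : ℕ} (G : SimpleGraph V)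
    (A : Finset V) (β : X × Fin M → V) (s : Fin m → X) (φ : V → V → ℝ)
    (hφ : ∀ v w, φ v w ≤ 1) (hφ' : ∀ v w, ¬ G.Adj v w → ¬ (v ∉ A ∧ w ∉ A) → φ v w ≤ 0)
    (B : Finset (Fin m × Fin M)) (hB : ∀ p, p ∈ B ↔ β (s p.1, p.2) ∈ A) :
    ∑ i, ∑ j ∈ univ.erase i, ∑ a, ∑ b, φ (β (s i, a)) (β (s j, b))
      ≤ (adjPairs (sampleGraph G β s)).card + ((Fintype.card (Fin m × Fin M) : ℝ) - B.card) ^ 2 := by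
  classical
  have h1 : ∑ i, ∑ j ∈ univ.erase i, ∑ a, ∑ b, φ (β (s i, a)) (β (s j, b))
      = ∑ p : (Fin m × Fin M) × (Fin m × Fin M),
        if p.2.1 ≠ p.1.1 then φ (β (s p.1.1, p.1.2)) (β (s p.2.1, p.2.2)) else 0 := by
    rw [Fintype.sum_prod_type, Fintype.sum_prod_type]
    refine sum_congr rfl fun i _ => ?_
    rw [sum_comm]
    refine sum_congr rfl fun a _ => ?_
    rw [Fintype.sum_prod_type, ← filter_ne', sum_filter]
    refine sum_congr rfl fun j _ => ?_
    split_ifs with h <;> simp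
  rw [h1]
  have h2 : ((adjPairs (sampleGraph G β s)).card : ℝ)
      = ∑ p : (Fin m × Fin M) × (Fin m × Fin M), if (sampleGraph G β s).Adj p.1 p.2 then 1 else 0 := by
    rw [sum_boole]
    congr 2
  have h3 : ((Fintype.card (Fin m × Fin M) : ℝ) - B.card) ^ 2
      = ∑ p : (Fin m × Fin M) × (Fin m × Fin M), if p.1 ∈ Bᶜ ∧ p.2 ∈ Bᶜ then 1 else 0 := by
    rw [sum_boole, ← Nat.cast_sub (card_le_univ B), ← card_compl, sq, ← Nat.cast_mul,
      ← card_product]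
    congr 2
    ext p
    simp
  rw [h2, h3, ← sum_add_distrib]
  refine sum_le_sum fun p _ => ?_
  by_cases hp : p.2.1 ≠ p.1.1
  · rw [if_pos hp]
    have := hφ (β (s p.1.1, p.1.2)) (β (s p.2.1, p.2.2))
    by_cases c1 : (sampleGraph G β s).Adj p.1 p.2
    · rw [if_pos c1]
      split_ifs <;> linarith
    · rw [if_neg c1]
      have c1' : ¬ G.Adj (β (s p.1.1, p.1.2)) (β (s p.2.1, p.2.2)) := fun h => c1 ⟨hp.symm, h⟩
      split_ifs with c2
      · linarith
      · rw [zero_add]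
        refine hφ' _ _ c1' fun h => c2 ?_
        rw [mem_compl, mem_compl, hB, hB]
        exact h
  · rw [if_neg hp]
    positivity

set_option maxHeartbeats 1000000 in
-- The hypotheses of the matching bound pass to a random sample, with `α` losing a constant factor
-- at each step. Only two statistics are needed: the mean block density of the weight `φ` and the
-- share of sampled points in `A`.
theorem card_samples_with_matching_ge {V X : Type*} [Fintype V] [Fintype X] (G : SimpleGraph V)
    (A : Finset V) (hA : ∀ x y, G.Adj x y → x ∈ A) (k M : ℕ) (hM : M = 3 * k + 2)
    (β : X × Fin M → V)
    (hβ : Function.Injective β) {α : ℝ} (hα : 0 < α) (hα' : α ≤ 2 / 3)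
    (hN : (2 / 3 + α / 2) * Fintype.card V ≤ A.card)
    (hD : (5 / 9 + 3 / 8 * α) * (Fintype.card V : ℝ) ^ 2 - ((Fintype.card V : ℝ) - A.card) ^ 2
      ≤ (adjPairs G).card)
    (hV : 0 < Fintype.card V)
    (hcover : (1 - α / 32) * Fintype.card V ≤ Fintype.card X * M)
    (hk : 64 / α ≤ k) {m : ℕ} (hm : 8 * (1 + 16 / α ^ 2) / α ≤ m) (hm2 : 2 ≤ m) :
    ∃ F : Finset (Fin m → X), α / 16 * (Fintype.card X : ℝ) ^ m ≤ F.card ∧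
      ∀ s ∈ F, ∃ 𝓜, IsPacking ends (fun p => (sampleGraph G β s).Adj p.1 p.2) 𝓜 ∧
        m * (k + 1) < 𝓜.card := by
  classical
  set n : ℝ := (Fintype.card V : ℝ) with hn
  set q : ℝ := (Fintype.card X : ℝ) with hq
  have hn0 : 0 < n := Nat.cast_pos.2 hV
  have hM0 : (0 : ℝ) < M := by rw [hM]; positivity
  have hqM : q * M ≤ n := by
    have := Fintype.card_le_of_injective β hβ
    rw [Fintype.card_prod, Fintype.card_fin] at this
    rw [hn, hq]
    exact_mod_cast this
  have hq0 : 0 < q := by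
    by_contra! h
    have : 0 < (1 - α / 32) * n := mul_pos (by linarith) hn0
    nlinarith
  have hm0 : (0 : ℝ) < m := by exact_mod_cast (by omega : 0 < m)
  have hXpos : 0 < Fintype.card X := Nat.cast_pos.1 hq0
  -- Counting the pairs outside `A` as well absorbs the correction `(n - |A|)²`, so that the edge
  -- condition becomes the plain statement that `φ` has density at least `5/9 + 3α/8`.
  set φ : V → V → ℝ := fun v w => if G.Adj v w ∨ (v ∉ A ∧ w ∉ A) then 1 else 0 with hφ
  have hφ0 : ∀ v w, 0 ≤ φ v w := fun v w => by simp only [hφ]; split_ifs <;> norm_num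
  have hφ1 : ∀ v w, φ v w ≤ 1 := fun v w => by simp only [hφ]; split_ifs <;> norm_num
  set w : X → X → ℝ := fun x y => (∑ a, ∑ b, φ (β (x, a)) (β (y, b))) / (M : ℝ) ^ 2 with hw
  set g : X → ℝ := fun x => (∑ a, if β (x, a) ∈ A then (1 : ℝ) else 0) / M with hg
  -- sums over all vertices
  have hφsum : (5 / 9 + 3 / 8 * α) * n ^ 2 ≤ ∑ p : V × V, φ p.1 p.2 := by
    have h1 : ∑ p : V × V, φ p.1 p.2 = (adjPairs G).card + (n - A.card) ^ 2 := by
      rw [hn, ← Nat.cast_sub (card_le_univ A), ← card_compl, sq, ← Nat.cast_mul, ← card_product,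
        ← Nat.cast_add, ← card_union_of_disjoint]
      · simp only [hφ]
        rw [sum_boole]
        congr 2
        ext p
        simp [mem_adjPairs]
      · rw [disjoint_left]
        intro p h1 h2
        rw [mem_adjPairs] at h1
        simp only [mem_product, mem_compl] at h2
        exact h2.1 (hA _ _ h1)
    rw [h1]; linarith
  have hq2 : n ^ 2 - α / 16 * n ^ 2 ≤ (q * M) ^ 2 := by
    have h0 : 0 ≤ (1 - α / 32) * n := mul_nonneg (by linarith) hn0.le
    nlinarith [pow_le_pow_left₀ h0 hcover 2, mul_nonneg (sq_nonneg α) (sq_nonneg n)]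
  have hsumw : (5 / 9 + α / 4) * q ^ 2 ≤ ∑ x, ∑ y, w x y := by
    have e1 : ∑ x, ∑ y, w x y = (∑ p : (X × Fin M) × (X × Fin M), φ (β p.1) (β p.2)) / (M : ℝ) ^ 2 := by
      simp only [hw, Fintype.sum_prod_type, sum_div]
      refine sum_congr rfl fun x _ => ?_
      rw [sum_comm]
    have hinj : Function.Injective (Prod.map β β) := hβ.prodMap hβ
    have e2 : ∑ p : (X × Fin M) × (X × Fin M), φ (β p.1) (β p.2)
        = ∑ p ∈ univ.map ⟨Prod.map β β, hinj⟩, φ p.1 p.2 := by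
      rw [sum_map]; rfl
    have e3 : ∑ p ∈ (univ.map ⟨Prod.map β β, hinj⟩)ᶜ, φ p.1 p.2 ≤ n ^ 2 - (q * M) ^ 2 := by
      refine (sum_le_sum fun p _ => hφ1 p.1 p.2).trans ?_
      rw [sum_const, nsmul_eq_mul, mul_one, card_compl, card_map, card_univ,
        Nat.cast_sub (Fintype.card_le_of_injective _ hinj)]
      simp only [Fintype.card_prod, Fintype.card_fin]
      push_cast
      rw [hn, hq]
      ring_nf
      exact le_rfl
    have e4 := sum_add_sum_compl (univ.map ⟨Prod.map β β, hinj⟩) fun p : V × V => φ p.1 p.2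
    rw [e1, e2, le_div_iff₀ (by positivity)]
    have h5 : (q * M) ^ 2 ≤ n ^ 2 := pow_le_pow_left₀ (by positivity) hqM 2
    have h6 : (5 / 9 + α / 4) * q ^ 2 * (M : ℝ) ^ 2 = (5 / 9 + α / 4) * (q * M) ^ 2 := by ring
    rw [h6]
    nlinarith
  set μ : ℝ := (∑ x, g x) / q with hμ
  have hμ' : 2 / 3 + α / 4 ≤ μ := by
    rw [hμ, le_div_iff₀ hq0]
    have e1 : ∑ x, g x = (∑ p : X × Fin M, if β p ∈ A then (1 : ℝ) else 0) / M := by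
      simp only [hg, Fintype.sum_prod_type, sum_div]
    have e2 : (∑ p : X × Fin M, if β p ∈ A then (1 : ℝ) else 0)
        = ∑ v ∈ univ.map ⟨β, hβ⟩, if v ∈ A then (1 : ℝ) else 0 := by
      rw [sum_map]; rfl
    have e3 : (∑ v ∈ (univ.map ⟨β, hβ⟩)ᶜ, if v ∈ A then (1 : ℝ) else 0) ≤ n - q * M := by
      refine (sum_le_sum (g := fun _ => (1 : ℝ)) fun p _ => by split_ifs <;> norm_num).trans ?_
      rw [sum_const, nsmul_eq_mul, mul_one, card_compl, card_map, card_univ,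
        Nat.cast_sub (Fintype.card_le_of_injective _ hβ)]
      simp [hn, hq]
    have e4 := sum_add_sum_compl (univ.map ⟨β, hβ⟩) fun v => if v ∈ A then (1 : ℝ) else 0
    have e5 : (∑ v, if v ∈ A then (1 : ℝ) else 0) = A.card := by simp
    rw [e1, e2, le_div_iff₀ hM0]
    nlinarith
  have hg0 : ∀ x, 0 ≤ g x := fun x => div_nonneg (sum_nonneg fun _ _ => by split_ifs <;> norm_num)
    hM0.le
  have hg1 : ∀ x, g x ≤ 1 := by
    intro x
    rw [hg, div_le_one hM0]
    calc (∑ a, if β (x, a) ∈ A then (1 : ℝ) else 0) ≤ ∑ _a : Fin M, (1 : ℝ) :=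
          sum_le_sum fun _ _ => by split_ifs <;> norm_num
      _ = M := by simp
  have hw0 : ∀ x y, 0 ≤ w x y := fun x y => div_nonneg (sum_nonneg fun _ _ =>
    sum_nonneg fun _ _ => hφ0 _ _) (by positivity)
  have hw1 : ∀ x y, w x y ≤ 1 := by
    intro x y
    rw [hw, div_le_one (by positivity)]
    calc ∑ a, ∑ b, φ (β (x, a)) (β (y, b)) ≤ ∑ _a : Fin M, ∑ _b : Fin M, (1 : ℝ) :=
          sum_le_sum fun _ _ => sum_le_sum fun _ _ => hφ1 _ _
      _ = (M : ℝ) ^ 2 := by simp; ring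
  -- Pairs not covered by blocks cost at most `α/16`, leaving density `5/9 + α/4`. Of the excess,
  -- `α/16` stays in the sample, `α/16` is the probability, and the remaining `α/8` pays for the
  -- diagonal and variance terms once `m` is large. The choice `K = 16 / α²` bounds the deviation by
  -- `m α / 4`, exactly the excess of `μ` over `2/3`.
  have hsample := card_filter_sample_ge hXpos w g hw0 hw1 hg0 hg1 (a := 5 / 9 + α / 4) (μ := μ)
    (τ := 5 / 9 + α / 16) (c := α / 16) (K := 16 / α ^ 2) (by positivity) (by positivity) hsumw
    (by rw [hμ]; field_simp; rfl) hm2 (by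
      rw [div_le_iff₀ hα] at hm
      have : (5 / 9 + α / 4 + 16 / α ^ 2) * m ≤ (m * α / 8) * m := by
        apply mul_le_mul_of_nonneg_right _ hm0.le
        linarith
      nlinarith)
  refine ⟨_, hsample, fun s hs => ?_⟩
  obtain ⟨hs1, hs2⟩ := (mem_filter.1 hs).2
  have hne : ∀ p : (Fin m × Fin M) × (Fin m × Fin M), (sampleGraph G β s).Adj p.1 p.2 →
      (ends p).Nonempty := fun p _ => ⟨p.1, by simp [ends]⟩
  obtain ⟨𝓜, h𝓜⟩ := exists_isMaxPacking ends (fun p => (sampleGraph G β s).Adj p.1 p.2) hne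
  refine ⟨𝓜, h𝓜.toIsPacking, ?_⟩
  set B : Finset (Fin m × Fin M) := univ.filter fun p => β (s p.1, p.2) ∈ A with hB
  have hBmem : ∀ p, p ∈ B ↔ β (s p.1, p.2) ∈ A := by simp [hB]
  have hQ : (Fintype.card (Fin m × Fin M) : ℝ) = m * M := by simp
  have hBcard : (B.card : ℝ) = M * ∑ i, g (s i) := by
    rw [hB, ← sum_boole, Fintype.sum_prod_type, mul_sum]
    refine sum_congr rfl fun i _ => ?_
    exact (mul_div_cancel₀ _ hM0.ne').symm
  have hdev : 2 / 3 * (m : ℝ) ≤ ∑ i, g (s i) := by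
    have h1 : (∑ i, g (s i) - m * μ) ^ 2 ≤ (m * α / 4) ^ 2 := by
      have : 16 / α ^ 2 * (∑ i, g (s i) - m * μ) ^ 2 * (α ^ 2 / 16) ≤ m ^ 2 * (α ^ 2 / 16) :=
        mul_le_mul_of_nonneg_right hs2 (by positivity)
      calc (∑ i, g (s i) - m * μ) ^ 2
          = 16 / α ^ 2 * (∑ i, g (s i) - m * μ) ^ 2 * (α ^ 2 / 16) := by field_simp
        _ ≤ _ := this
        _ = _ := by ring
    have h2 := (abs_le_of_sq_le_sq' h1 (by positivity)).1
    have h3 := mul_le_mul_of_nonneg_left hμ' hm0.le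
    linarith
  have hMk : (M : ℝ) = 3 * k + 2 := by rw [hM]; push_cast; ring
  have hαM : 12 ≤ α / 16 * M := by
    rw [div_le_iff₀ hα] at hk
    rw [hMk]; linarith
  have hm1 : (2 : ℝ) ≤ m := by exact_mod_cast hm2
  have hmM := mul_le_mul_of_nonneg_left hαM hm0.le
  have := lt_card_of_isMaxPacking (sampleGraph G β s) h𝓜 B
    (fun x y hxy => (hBmem x).2 (hA _ _ hxy.2)) (ε := α / 16) (m := m) hm0.le
    (by rw [hQ]; linarith) (by rw [hQ]; linarith)
    (by rw [hQ]; exact le_mul_of_one_le_right hm0.le (by rw [hMk]; linarith [k.cast_nonneg (α := ℝ)]))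
    (by rw [hQ, hBcard]; linarith [mul_le_mul_of_nonneg_left hdev hM0.le]) (by
      have h1 := adjPairs_sampleGraph_ge G A β s φ hφ1 (by
        intro v w h1 h2
        simp only [hφ]
        rw [if_neg (by tauto)]) B hBmem
      have h2 : ∑ i, ∑ j ∈ univ.erase i, ∑ a, ∑ b, φ (β (s i, a)) (β (s j, b))
          = (M : ℝ) ^ 2 * ∑ i, ∑ j ∈ univ.erase i, w (s i) (s j) := by
        rw [mul_sum]
        refine sum_congr rfl fun i _ => ?_
        rw [mul_sum]
        refine sum_congr rfl fun j _ => ?_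
        exact (mul_div_cancel₀ _ (pow_ne_zero 2 hM0.ne')).symm
      rw [h2] at h1
      have h3 := mul_le_mul_of_nonneg_left hs1 (by positivity : 0 ≤ (M : ℝ) ^ 2)
      have h4 : (5 / 9 + α / 16) * (Fintype.card (Fin m × Fin M) : ℝ) ^ 2
          = (M : ℝ) ^ 2 * ((5 / 9 + α / 16) * m ^ 2) := by rw [hQ]; ring
      linarith)
  rw [hQ, hMk] at this
  -- The sample has `m M = m (3k + 2)` points; the extra `m` completes this to `3 m (k + 1)`.
  have h5 : ((m : ℝ) * (3 * k + 2) + m) / 3 = m * (k + 1) := by ring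
  rw [h5] at this
  exact_mod_cast this

/-! ### Blow-ups by the power mean inequality. -/

/-- For fixed `y` the sum over `h` factorizes as `(∑ x, f y x) ^ (T + 1)`; the claim is then the
power mean inequality over `y`. -/
theorem avg_pow_le_avg_prod {Y X : Type*} [Fintype Y] [Fintype X] (T : ℕ)
    (f : Y → X → ℝ) (hf : ∀ y x, 0 ≤ f y x) :
    ((∑ y, ∑ x, f y x) / (Fintype.card Y * Fintype.card X)) ^ (T + 1)
      ≤ (∑ y, ∑ h : Fin (T + 1) → X, ∏ t, f y (h t))
        / (Fintype.card Y * (Fintype.card X : ℝ) ^ (T + 1)) := by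
  rcases isEmpty_or_nonempty Y with hY | hY
  · simp
  have h1 := pow_sum_div_card_le_sum_pow (s := (univ : Finset Y)) (f := fun y => ∑ x, f y x)
    (fun y _ => sum_nonneg fun x _ => hf y x) T
  have h2 : ∀ y, ∑ h : Fin (T + 1) → X, ∏ t, f y (h t) = (∑ x, f y x) ^ (T + 1) := fun y =>
    (Fintype.sum_pow (f y) (T + 1)).symm
  simp only [h2]
  rw [card_univ] at h1
  have hY0 : (0 : ℝ) < Fintype.card Y := by exact_mod_cast Fintype.card_pos
  calc ((∑ y, ∑ x, f y x) / (Fintype.card Y * Fintype.card X)) ^ (T + 1)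
      = (∑ y, ∑ x, f y x) ^ (T + 1) / (Fintype.card Y : ℝ) ^ T
        / (Fintype.card Y * (Fintype.card X : ℝ) ^ (T + 1)) := by
        rw [div_pow, mul_pow, div_div]; congr 1; ring
    _ ≤ _ := div_le_div_of_nonneg_right h1 (by positivity)

theorem sum_fin_succ_fun {X : Type*} [Fintype X] {m : ℕ} (f : (Fin (m + 1) → X) → ℝ) :
    ∑ s, f s = ∑ x, ∑ s : Fin m → X, f (Fin.cons x s) := by
  rw [← (Fin.consEquiv fun _ => X).sum_comp, Fintype.sum_prod_type]
  rfl

theorem prod_fin_succ_fun {X : Type*} [Fintype X] {m : ℕ} (f : (Fin (m + 1) → X) → ℝ) :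
    ∏ s, f s = ∏ x, ∏ s : Fin m → X, f (Fin.cons x s) := by
  rw [← (Fin.consEquiv fun _ => X).prod_comp, Fintype.prod_prod_type]
  rfl

/-- The density of blow-ups: a function on `Y × X ^ m` of average `c` has average at least
`c ^ (T ^ m)` over the products along boxes with sides of size `T`. -/
theorem avg_pow_le_avg_box {X : Type u} [Fintype X] (T : ℕ) (m : ℕ) :
    ∀ (Y : Type u) [Fintype Y] (f : Y → (Fin m → X) → ℝ), (∀ y s, 0 ≤ f y s) →
    ((∑ y, ∑ s, f y s) / (Fintype.card Y * (Fintype.card X : ℝ) ^ m)) ^ ((T + 1) ^ m)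
      ≤ (∑ y, ∑ g : Fin m → Fin (T + 1) → X, ∏ σ : Fin m → Fin (T + 1), f y fun i => g i (σ i))
        / (Fintype.card Y * ((Fintype.card X : ℝ) ^ (T + 1)) ^ m) := by
  induction m with
  | zero =>
    intro Y _ f hf
    simp only [pow_zero, pow_one, univ_unique, sum_singleton, prod_singleton, mul_one]
    apply le_of_eq
    congr 1
    refine sum_congr rfl fun y _ => ?_
    congr 1
    exact Subsingleton.elim _ _
  | succ m ih =>
    intro Y _ f hf
    -- The first coordinate is treated as part of the parameter space while the others are blown up,
    -- which is why `Y` is arbitrary in the induction. The first coordinate is then blown up with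
    -- the remaining boxes as parameters.
    have h1 := ih (Y × X) (fun p s => f p.1 (Fin.cons p.2 s)) (fun _ _ => hf _ _)
    have h2 := avg_pow_le_avg_prod T
      (fun (p : Y × (Fin m → Fin (T + 1) → X)) (x : X) => ∏ σ : Fin m → Fin (T + 1),
        f p.1 (Fin.cons x fun i => p.2 i (σ i))) (fun _ _ => prod_nonneg fun _ _ => hf _ _)
    have e1 : (∑ p : Y × X, ∑ s : Fin m → X, f p.1 (Fin.cons p.2 s)) = ∑ y, ∑ s, f y s := by
      rw [Fintype.sum_prod_type]
      exact sum_congr rfl fun y _ => (sum_fin_succ_fun (f y)).symm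
    have e2 : (∑ p : Y × X, ∑ g : Fin m → Fin (T + 1) → X, ∏ σ : Fin m → Fin (T + 1),
          f p.1 (Fin.cons p.2 fun i => g i (σ i)))
        = ∑ p : Y × (Fin m → Fin (T + 1) → X), ∑ x, ∏ σ : Fin m → Fin (T + 1),
          f p.1 (Fin.cons x fun i => p.2 i (σ i)) := by
      rw [Fintype.sum_prod_type, Fintype.sum_prod_type]
      exact sum_congr rfl fun y _ => sum_comm
    have e3 : (∑ y, ∑ g : Fin (m + 1) → Fin (T + 1) → X, ∏ σ : Fin (m + 1) → Fin (T + 1),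
          f y fun i => g i (σ i))
        = ∑ p : Y × (Fin m → Fin (T + 1) → X), ∑ h : Fin (T + 1) → X, ∏ t,
          ∏ σ : Fin m → Fin (T + 1), f p.1 (Fin.cons (h t) fun i => p.2 i (σ i)) := by
      rw [Fintype.sum_prod_type]
      refine sum_congr rfl fun y _ => ?_
      rw [sum_fin_succ_fun, sum_comm]
      refine sum_congr rfl fun g _ => sum_congr rfl fun h _ => ?_
      rw [prod_fin_succ_fun]
      refine prod_congr rfl fun t _ => prod_congr rfl fun σ _ => ?_
      congr 1
      funext i
      refine Fin.cases ?_ (fun j => ?_) i <;> simp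
    rw [e1, e2] at h1
    rw [e3]
    have h0 : 0 ≤ (∑ y, ∑ s, f y s) / (Fintype.card Y * (Fintype.card X : ℝ) ^ (m + 1)) :=
      div_nonneg (sum_nonneg fun _ _ => sum_nonneg fun _ _ => hf _ _) (by positivity)
    have d1 : (Fintype.card (Y × X) : ℝ) * (Fintype.card X : ℝ) ^ m
        = Fintype.card Y * (Fintype.card X : ℝ) ^ (m + 1) := by
      rw [Fintype.card_prod]; push_cast; ring
    have d2 : (Fintype.card (Y × X) : ℝ) * ((Fintype.card X : ℝ) ^ (T + 1)) ^ m
        = (Fintype.card (Y × (Fin m → Fin (T + 1) → X)) : ℝ) * Fintype.card X := by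
      simp only [Fintype.card_prod, Fintype.card_fun, Fintype.card_fin]; push_cast; ring
    have d3 : (Fintype.card Y : ℝ) * ((Fintype.card X : ℝ) ^ (T + 1)) ^ (m + 1)
        = (Fintype.card (Y × (Fin m → Fin (T + 1) → X)) : ℝ) * (Fintype.card X : ℝ) ^ (T + 1) := by
      simp only [Fintype.card_prod, Fintype.card_fun, Fintype.card_fin]; push_cast; ring
    rw [d1, d2] at h1
    rw [d3, pow_succ (T + 1) m, pow_mul]
    exact (pow_le_pow_left₀ (pow_nonneg h0 _) h1 _).trans h2

/-- Union bound: any two fixed coordinates agree in a `1 / |X|` fraction of the functions. -/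
theorem card_not_injective_mul_le {ι X : Type*} [Fintype ι] [Fintype X] [DecidableEq ι]
    [DecidableEq X] :
    ((univ.filter fun s : ι → X => ¬ Function.Injective s).card : ℝ) * Fintype.card X
      ≤ (Fintype.card ι : ℝ) ^ 2 * (Fintype.card X : ℝ) ^ Fintype.card ι := by
  set D : ι × ι → Finset (ι → X) := fun p => univ.filter fun s => s p.1 = s p.2 with hD
  set P : Finset (ι × ι) := univ.filter fun p => p.1 ≠ p.2 with hP
  have h1 : (univ.filter fun s : ι → X => ¬ Function.Injective s) ⊆ P.biUnion D := by
    intro s hs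
    have := (mem_filter.1 hs).2
    simp only [Function.Injective, not_forall] at this
    obtain ⟨i, j, h, hij⟩ := this
    exact mem_biUnion.2 ⟨(i, j), by simpa [hP] using hij, by simpa [hD] using h⟩
  have h2 : ∀ p ∈ P, ((D p).card : ℝ) * Fintype.card X
      = (Fintype.card X : ℝ) ^ Fintype.card ι := by
    intro p hp
    have hne : p.1 ≠ p.2 := (mem_filter.1 hp).2
    have := sum_apply_apply_eq hne (fun x y : X => if x = y then (1 : ℝ) else 0)
    rw [sum_boole] at this
    rw [hD, this]
    have h3 : 2 ≤ Fintype.card ι := by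
      have := card_le_univ ({p.1, p.2} : Finset ι)
      rwa [card_pair hne] at this
    simp only [sum_ite_eq, mem_univ, if_true, sum_const, card_univ, nsmul_eq_mul, mul_one]
    rw [mul_assoc, ← sq, ← pow_add]
    congr 1
    omega
  have h3 : (P.card : ℝ) ≤ (Fintype.card ι : ℝ) ^ 2 := by
    have := card_le_univ P
    rw [Fintype.card_prod, ← sq] at this
    exact_mod_cast this
  calc ((univ.filter fun s : ι → X => ¬ Function.Injective s).card : ℝ) * Fintype.card X
      ≤ (∑ p ∈ P, ((D p).card : ℝ)) * Fintype.card X := by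
        apply mul_le_mul_of_nonneg_right _ (by positivity)
        exact_mod_cast (card_le_card h1).trans card_biUnion_le
    _ = P.card * (Fintype.card X : ℝ) ^ Fintype.card ι := by
        rw [sum_mul, sum_congr rfl h2, sum_const, nsmul_eq_mul]
    _ ≤ _ := mul_le_mul_of_nonneg_right h3 (by positivity)

/-- On average a box is good for a fraction `c ^ ((T + 1) ^ m)` of `Y`. Boxes with a repeated entry
contribute less than half of this when `X` is large, so some injective box achieves half the
average. -/
theorem exists_injective_box {Y X : Type u} [Fintype Y] [Fintype X] (hY : 0 < Fintype.card Y)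
    (T m : ℕ) {c : ℝ} (hc : 0 ≤ c) (r : Y → (Fin m → X) → Prop)
    (hr : c * (Fintype.card Y * (Fintype.card X : ℝ) ^ m)
      ≤ ∑ y, (({s | r y s} : Set (Fin m → X)).ncard : ℝ))
    (hX : 2 * ((m * (T + 1) : ℕ) : ℝ) ^ 2 < c ^ ((T + 1) ^ m) * Fintype.card X) :
    ∃ g : Fin m → Fin (T + 1) → X,
      Function.Injective (fun p : Fin m × Fin (T + 1) => g p.1 p.2) ∧
      c ^ ((T + 1) ^ m) / 2 * Fintype.card Y
        ≤ (({y | ∀ σ : Fin m → Fin (T + 1), r y fun i => g i (σ i)} : Set Y).ncard : ℝ) := by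
  classical
  set q : ℝ := (Fintype.card X : ℝ) with hq
  set C : ℝ := c ^ ((T + 1) ^ m) with hC
  have hC0 : 0 ≤ C := pow_nonneg hc _
  have hq0 : 0 < q := by
    by_contra! h
    have : 0 ≤ 2 * ((m * (T + 1) : ℕ) : ℝ) ^ 2 := by positivity
    nlinarith
  have hYpos : (0 : ℝ) < Fintype.card Y := by exact_mod_cast hY
  set cnt : (Fin m → Fin (T + 1) → X) → ℝ := fun g =>
    (({y | ∀ σ : Fin m → Fin (T + 1), r y fun i => g i (σ i)} : Set Y).ncard : ℝ) with hcnt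
  have h1 := avg_pow_le_avg_box T m Y (fun y s => if r y s then (1 : ℝ) else 0)
    (fun _ _ => by split_ifs <;> norm_num)
  have e1 : ∀ y, ∑ s : Fin m → X, (if r y s then (1 : ℝ) else 0)
      = (({s | r y s} : Set (Fin m → X)).ncard : ℝ) := by
    intro y
    rw [sum_boole, Set.ncard_eq_toFinset_card']
    congr 2
    ext; simp
  have e2 : (∑ y, ∑ g : Fin m → Fin (T + 1) → X, ∏ σ : Fin m → Fin (T + 1),
      if r y (fun i => g i (σ i)) then (1 : ℝ) else 0) = ∑ g, cnt g := by
    rw [sum_comm]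
    refine sum_congr rfl fun g _ => ?_
    have : ∀ y, (∏ σ : Fin m → Fin (T + 1), if r y (fun i => g i (σ i)) then (1 : ℝ) else 0)
        = if ∀ σ : Fin m → Fin (T + 1), r y (fun i => g i (σ i)) then 1 else 0 := by
      intro y
      rw [prod_boole]
      simp
    simp only [this]
    simp only [hcnt]
    rw [sum_boole, Set.ncard_eq_toFinset_card']
    congr 2
    ext; simp
  simp only [e1] at h1
  rw [e2, le_div_iff₀ (by positivity)] at h1
  have h2 : C * (Fintype.card Y * (q ^ (T + 1)) ^ m) ≤ ∑ g, cnt g := by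
    refine le_trans ?_ h1
    apply mul_le_mul_of_nonneg_right _ (by positivity)
    apply pow_le_pow_left₀ hc
    rw [le_div_iff₀ (by positivity)]
    exact hr
  by_contra! hcon
  have hcntY : ∀ g, cnt g ≤ Fintype.card Y := by
    intro g
    simp only [hcnt]
    rw [← Nat.card_eq_fintype_card]
    exact_mod_cast Set.ncard_le_card _
  set inj : (Fin m → Fin (T + 1) → X) → Prop := fun g =>
    Function.Injective (fun p : Fin m × Fin (T + 1) => g p.1 p.2) with hinj
  have h3 : ∑ g, cnt g ≤ C / 2 * Fintype.card Y * (q ^ (T + 1)) ^ m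
      + (univ.filter fun g => ¬ inj g).card * Fintype.card Y := by
    calc ∑ g, cnt g ≤ ∑ g, (C / 2 * Fintype.card Y + if ¬ inj g then (Fintype.card Y : ℝ) else 0) := by
          refine sum_le_sum fun g _ => ?_
          by_cases hg : inj g
          · simpa [hg] using (hcon g hg).le
          · rw [if_pos hg]
            have := hcntY g
            have : 0 ≤ C / 2 * Fintype.card Y := by positivity
            linarith
      _ = _ := by
          rw [sum_add_distrib, sum_const, ← sum_filter, sum_const, card_univ]
          simp only [Fintype.card_fun, Fintype.card_fin, nsmul_eq_mul]
          push_cast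
          ring
  have h4 : ((univ.filter fun g => ¬ inj g).card : ℝ) * q
      ≤ ((m * (T + 1) : ℕ) : ℝ) ^ 2 * (q ^ (T + 1)) ^ m := by
    have := card_not_injective_mul_le (ι := Fin m × Fin (T + 1)) (X := X)
    have e : (univ.filter fun g => ¬ inj g).card
        = (univ.filter fun s : Fin m × Fin (T + 1) → X => ¬ Function.Injective s).card := by
      refine card_equiv (Equiv.curry _ _ _).symm fun g => ?_
      simp only [mem_filter, mem_univ, true_and, hinj]
      rfl
    rw [e]
    simp only [Fintype.card_prod, Fintype.card_fin] at this
    rw [← pow_mul, mul_comm (T + 1) m]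
    exact this
  have hqm : 0 < (q ^ (T + 1)) ^ m := by positivity
  set Z := (q ^ (T + 1)) ^ m
  set bad : ℝ := ((univ.filter fun g => ¬ inj g).card : ℝ)
  have h5 : C / 2 * Z ≤ bad := by
    have : Fintype.card Y * (C / 2 * Z) ≤ Fintype.card Y * bad := by linarith
    exact le_of_mul_le_mul_left this hYpos
  have h6 : C / 2 * Z * q ≤ ((m * (T + 1) : ℕ) : ℝ) ^ 2 * Z :=
    (mul_le_mul_of_nonneg_right h5 hq0.le).trans h4
  have h7 : C / 2 * q ≤ ((m * (T + 1) : ℕ) : ℝ) ^ 2 := by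
    refine le_of_mul_le_mul_right ?_ hqm
    linarith
  linarith

/-- The proportion of the vertices of `U` guaranteed by `exists_common_blowup`. -/
noncomputable def blowupDensity (α : ℝ) (k m : ℕ) : ℝ :=
  (α / 16 / Fintype.card (Finset ((Fin m × Fin (3 * k + 2)) × (Fin m × Fin (3 * k + 2)))))
    ^ ((k + 1) ^ m)

theorem blowupDensity_pos {α : ℝ} (hα : 0 < α) (k m : ℕ) : 0 < blowupDensity α k m := by
  unfold blowupDensity
  have : 0 < Fintype.card (Finset ((Fin m × Fin (3 * k + 2)) × (Fin m × Fin (3 * k + 2)))) :=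
    Fintype.card_pos
  positivity

/-- Each `u ∈ U` has a fraction `α / 16` of good samples. Pigeonhole over the boundedly many sets
`𝓜` fixes one matching with positive density in `U × X ^ m`, and the box lemma blows it up. -/
theorem exists_common_blowup {V X : Type u} [Fintype V] [Fintype X] (G : V → SimpleGraph V)
    (A : V → Finset V) (U : Finset V) (hU : U.Nonempty)
    (hA : ∀ u, ∀ x y, (G u).Adj x y → x ∈ A u) (k : ℕ)
    (β : X × Fin (3 * k + 2) → V)
    (hβ : Function.Injective β) {α : ℝ} (hα : 0 < α) (hα' : α ≤ 2 / 3)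
    (hN : ∀ u ∈ U, (2 / 3 + α / 2) * Fintype.card V ≤ (A u).card)
    (hD : ∀ u ∈ U, (5 / 9 + 3 / 8 * α) * (Fintype.card V : ℝ) ^ 2
      - ((Fintype.card V : ℝ) - (A u).card) ^ 2 ≤ (adjPairs (G u)).card)
    (hcover : (1 - α / 32) * Fintype.card V ≤ Fintype.card X * ((3 * k + 2 : ℕ) : ℝ))
    (hk : 64 / α ≤ k) {m : ℕ} (hm : 8 * (1 + 16 / α ^ 2) / α ≤ m) (hm2 : 2 ≤ m)
    (hX : 2 * ((m * (k + 1) : ℕ) : ℝ) ^ 2 < blowupDensity α k m * Fintype.card X) :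
    ∃ (g : Fin m → Fin (k + 1) → X)
      (𝓜 : Finset ((Fin m × Fin (3 * k + 2)) × (Fin m × Fin (3 * k + 2)))) (U' : Finset V),
      Function.Injective (fun p : Fin m × Fin (k + 1) => g p.1 p.2) ∧
      (𝓜 : Set ((Fin m × Fin (3 * k + 2)) × (Fin m × Fin (3 * k + 2)))).PairwiseDisjoint ends ∧ (∀ p ∈ 𝓜, p.1.1 ≠ p.2.1) ∧ m * (k + 1) < 𝓜.card ∧
      U' ⊆ U ∧ blowupDensity α k m / 2 * U.card ≤ U'.card ∧
      ∀ p ∈ 𝓜, ∀ u ∈ U', ∀ t t',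
        (G u).Adj (β (g p.1.1 t, p.1.2)) (β (g p.2.1 t', p.2.2)) := by
  classical
  have hV : 0 < Fintype.card V := Fintype.card_pos_iff.2 ⟨hU.choose⟩
  set I := (Fin m × Fin (3 * k + 2)) × (Fin m × Fin (3 * k + 2)) with hI
  set r : Finset I → U → (Fin m → X) → Prop := fun 𝓜 u s =>
    IsPacking ends (fun p => (sampleGraph (G u) β s).Adj p.1 p.2) 𝓜 ∧ m * (k + 1) < 𝓜.card with hr
  set q : ℝ := (Fintype.card X : ℝ) with hq
  have h1 : ∀ u : U, α / 16 * q ^ m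
      ≤ ∑ 𝓜 : Finset I, (({s | r 𝓜 u s} : Set (Fin m → X)).ncard : ℝ) := by
    intro u
    obtain ⟨F, hF, hF'⟩ := card_samples_with_matching_ge (G u) (A u) (hA u) k _ rfl β hβ hα hα'
      (hN u u.2) (hD u u.2) hV hcover hk hm hm2
    refine hF.trans ?_
    have : F ⊆ univ.biUnion fun 𝓜 : Finset I => univ.filter fun s => r 𝓜 u s := by
      intro s hs
      obtain ⟨𝓜, h⟩ := hF' s hs
      exact mem_biUnion.2 ⟨𝓜, mem_univ _, mem_filter.2 ⟨mem_univ _, h⟩⟩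
    have h2 : ∀ 𝓜, ({s | r 𝓜 u s} : Set (Fin m → X)).ncard
        = (univ.filter fun s => r 𝓜 u s).card := by
      intro 𝓜
      rw [Set.ncard_eq_toFinset_card']
      congr 1
      ext; simp
    simp only [h2]
    exact_mod_cast (card_le_card this).trans card_biUnion_le
  have hL : (0 : ℝ) < Fintype.card (Finset I) := by exact_mod_cast Fintype.card_pos
  have hUpos : 0 < Fintype.card U := by simpa using hU
  obtain ⟨𝓜, -, h𝓜⟩ : ∃ 𝓜 ∈ (univ : Finset (Finset I)),
      α / 16 / Fintype.card (Finset I) * (Fintype.card U * q ^ m)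
        ≤ ∑ u : U, (({s | r 𝓜 u s} : Set (Fin m → X)).ncard : ℝ) := by
    refine exists_le_of_sum_le univ_nonempty ?_
    rw [sum_comm, sum_const, card_univ, nsmul_eq_mul]
    calc (Fintype.card (Finset I) : ℝ) * (α / 16 / Fintype.card (Finset I)
          * (Fintype.card U * q ^ m)) = ∑ _u : U, α / 16 * q ^ m := by
          rw [sum_const, card_univ, nsmul_eq_mul]; field_simp
      _ ≤ _ := sum_le_sum fun u _ => h1 u
  obtain ⟨g, hg, hcard⟩ := exists_injective_box hUpos k m (by positivity) (r 𝓜) h𝓜 hX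
  change blowupDensity α k m / 2 * _ ≤ _ at hcard
  set U' : Finset U := univ.filter fun y =>
    ∀ σ : Fin m → Fin (k + 1), r 𝓜 y fun i => g i (σ i) with hU'
  have hcard' : blowupDensity α k m / 2 * U.card ≤ U'.card := by
    rw [Fintype.card_coe] at hcard
    refine hcard.trans (le_of_eq ?_)
    rw [Set.ncard_eq_toFinset_card']
    congr 2
    ext; simp [hU']
  have hpos : 0 < U'.card := by
    have := blowupDensity_pos hα k m
    have hU0 : (0 : ℝ) < U.card := by exact_mod_cast hU.card_pos
    have : (0 : ℝ) < U'.card := lt_of_lt_of_le (by positivity) hcard'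
    exact_mod_cast this
  have hall : ∀ u ∈ U', ∀ σ : Fin m → Fin (k + 1), r 𝓜 u fun i => g i (σ i) := fun u hu =>
    (mem_filter.1 hu).2
  obtain ⟨u0, hu0⟩ := card_pos.1 hpos
  have h0 := hall u0 hu0 fun _ => 0
  refine ⟨g, 𝓜, U'.map (Function.Embedding.subtype _), hg, h0.1.disj,
    fun p hp => (h0.1.isGood p hp).1, h0.2, ?_, ?_, ?_⟩
  · intro x hx
    obtain ⟨y, -, rfl⟩ := mem_map.1 hx
    exact y.2
  · rwa [card_map]
  · intro p hp u hu t t'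
    obtain ⟨y, hy, rfl⟩ := mem_map.1 hu
    have hne := (h0.1.isGood p hp).1
    -- The two ends lie in different coordinates of the sample, so `t` and `t'` can be prescribed
    -- independently by one choice function. This is why edges inside a block were discarded.
    have := ((hall y hy (Function.update (fun _ => t) p.2.1 t')).1.isGood p hp).2
    simpa [Function.update_of_ne hne] using this

/-! ### Tight walks and zigzag paths. -/

section

variable {V : Type*}

theorem IsTightWalk.mono {H : Hypergraph V} {l l' : List V} (h : IsTightWalk H l)
    (hl : l' <:+: l) : IsTightWalk H l' := fun a b c habc => h a b c (habc.trans hl)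

/-- A window of three consecutive terms cannot reach both sides of a shared pair. -/
theorem isTightWalk_append_pair {H : Hypergraph V} {x y : V} {l₂ : List V} :
    ∀ {l₁ : List V}, IsTightWalk H (l₁ ++ [x, y]) → IsTightWalk H ([x, y] ++ l₂) →
      IsTightWalk H (l₁ ++ [x, y] ++ l₂)
  | [], _, h₂ => by simpa using h₂
  | a :: l₁, h₁, h₂ => by
    intro u v w huvw
    rw [List.cons_append, List.cons_append, List.infix_cons_iff] at huvw
    rcases huvw with h | h
    · refine h₁ u v w (List.IsPrefix.isInfix ?_)
      rw [← List.cons_append] at h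
      exact List.prefix_of_prefix_length_le h ((a :: (l₁ ++ [x, y])).prefix_append l₂) (by simp)
    · exact isTightWalk_append_pair (h₁.mono (List.suffix_cons _ _).isInfix) h₂ u v w h

/-- The sequence `a 0, b 0, u 0, a 1, b 1, u 1, …, u (k - 1), a k, b k`. -/
def zigzag (a b u : ℕ → V) : ℕ → List V
  | 0 => [a 0, b 0]
  | k + 1 => zigzag a b u k ++ [u k, a (k + 1), b (k + 1)]

theorem length_zigzag (a b u : ℕ → V) (k : ℕ) : (zigzag a b u k).length = 3 * k + 2 := by
  induction k with
  | zero => rfl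
  | succ k ih => simp [zigzag, ih]; ring

theorem mem_zigzag {a b u : ℕ → V} {k : ℕ} {v : V} :
    v ∈ zigzag a b u k ↔ (∃ i ≤ k, v = a i) ∨ (∃ i ≤ k, v = b i) ∨ ∃ i < k, v = u i := by
  induction k with
  | zero => simp [zigzag]
  | succ k ih =>
    simp only [zigzag, List.mem_append, ih, List.mem_cons, List.not_mem_nil, or_false]
    constructor
    · rintro ((⟨i, hi, h⟩ | ⟨i, hi, h⟩ | ⟨i, hi, h⟩) | h | h | h)
      · exact Or.inl ⟨i, by omega, h⟩
      · exact Or.inr (Or.inl ⟨i, by omega, h⟩)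
      · exact Or.inr (Or.inr ⟨i, by omega, h⟩)
      · exact Or.inr (Or.inr ⟨k, by omega, h⟩)
      · exact Or.inl ⟨k + 1, le_rfl, h⟩
      · exact Or.inr (Or.inl ⟨k + 1, le_rfl, h⟩)
    · rintro (⟨i, hi, h⟩ | ⟨i, hi, h⟩ | ⟨i, hi, h⟩)
      · rcases hi.lt_or_eq with h1 | rfl
        · exact Or.inl (Or.inl ⟨i, by omega, h⟩)
        · tauto
      · rcases hi.lt_or_eq with h1 | rfl
        · exact Or.inl (Or.inr (Or.inl ⟨i, by omega, h⟩))
        · tauto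
      · rcases (Nat.lt_succ_iff.1 hi).lt_or_eq with h1 | rfl
        · exact Or.inl (Or.inr (Or.inr ⟨i, by omega, h⟩))
        · tauto

theorem prefix_zigzag (a b u : ℕ → V) (k : ℕ) : [a 0, b 0] <+: zigzag a b u k := by
  induction k with
  | zero => exact List.prefix_rfl
  | succ k ih => exact ih.trans (List.prefix_append _ _)

theorem exists_zigzag_eq_append (a b u : ℕ → V) (k : ℕ) :
    ∃ l, zigzag a b u k = l ++ [a k, b k] := by
  cases k with
  | zero => exact ⟨[], rfl⟩
  | succ k => exact ⟨zigzag a b u k ++ [u k], by simp [zigzag]⟩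

/-- Every three consecutive terms of the zigzag consist of one `a`, one `b` and one `u`. -/
theorem isTightPath_zigzag {H : Hypergraph V} {a b u : ℕ → V} {k : ℕ}
    (hE : ∀ i j l, i ≤ k → j ≤ k → l < k → ({u l, a i, b j} : Set V) ∈ H.edgeSet)
    (ha : Set.InjOn a (Set.Iic k)) (hb : Set.InjOn b (Set.Iic k)) (hu : Set.InjOn u (Set.Iio k))
    (hab : ∀ i j, i ≤ k → j ≤ k → a i ≠ b j) (hau : ∀ i l, i ≤ k → l < k → a i ≠ u l)
    (hbu : ∀ i l, i ≤ k → l < k → b i ≠ u l) : IsTightPath H (zigzag a b u k) := by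
  refine ⟨by rw [length_zigzag]; omega, ?_, ?_⟩
  · suffices ∀ j ≤ k, (zigzag a b u j).Nodup from this k le_rfl
    intro j
    induction j with
    | zero => intro _; simp [zigzag, hab 0 0]
    | succ j ih =>
      intro hj
      rw [zigzag, List.nodup_append]
      refine ⟨ih (by omega), ?_, ?_⟩
      · simp [hab (j + 1) (j + 1) hj hj, (hau (j + 1) j hj (by omega)).symm,
          (hbu (j + 1) j hj (by omega)).symm]
      · intro v hv w hw
        rw [mem_zigzag] at hv
        simp only [List.mem_cons, List.not_mem_nil, or_false] at hw
        rcases hv with ⟨i, hi, rfl⟩ | ⟨i, hi, rfl⟩ | ⟨i, hi, rfl⟩ <;>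
          rcases hw with rfl | rfl | rfl
        · exact hau _ _ (by omega) (by omega)
        · exact fun e => by
            have := ha (Set.mem_Iic.2 (by omega)) (Set.mem_Iic.2 (by omega)) e; omega
        · exact hab _ _ (by omega) (by omega)
        · exact hbu _ _ (by omega) (by omega)
        · exact (hab _ _ (by omega) (by omega)).symm
        · exact fun e => by
            have := hb (Set.mem_Iic.2 (by omega)) (Set.mem_Iic.2 (by omega)) e; omega
        · exact fun e => by
            have := hu (Set.mem_Iio.2 (by omega)) (Set.mem_Iio.2 (by omega)) e; omega
        · exact (hau _ _ (by omega) (by omega)).symm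
        · exact (hbu _ _ (by omega) (by omega)).symm
  · suffices ∀ j ≤ k, IsTightWalk H (zigzag a b u j) from this k le_rfl
    intro j
    induction j with
    | zero =>
      intro _ x y z h
      have := h.length_le
      simp [zigzag] at this
    | succ j ih =>
      intro hj
      obtain ⟨l, hl⟩ := exists_zigzag_eq_append a b u j
      have h1 := ih (by omega)
      rw [zigzag, hl]
      rw [hl] at h1
      refine isTightWalk_append_pair h1 ?_
      have e1 := hE j j j (by omega) (by omega) (by omega)
      have e2 := hE (j + 1) j j (by omega) (by omega) (by omega)
      have e3 := hE (j + 1) (j + 1) j (by omega) (by omega) (by omega)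
      intro x y z h
      simp only [List.cons_append, List.nil_append, List.infix_cons_iff, List.cons_prefix_cons,
        List.nil_prefix, List.prefix_nil, List.infix_nil, reduceCtorEq, and_true, and_false,
        or_false] at h
      rcases h with ⟨rfl, rfl, rfl⟩ | ⟨rfl, rfl, rfl⟩ | ⟨rfl, rfl, rfl⟩
      · convert e1 using 1; ext; simp; tauto
      · convert e2 using 1; ext; simp; tauto
      · exact e3

theorem prefix_pair_unique {x y x' y' : V} {l : List V} (h : [x, y] <+: l) (h' : [x', y'] <+: l) :
    x = x' ∧ y = y' := by
  have := List.prefix_of_prefix_length_le h h' (by simp)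
  have := this.eq_of_length (by simp)
  simpa using this

theorem suffix_pair_unique {x y x' y' : V} {l : List V} (h : [x, y] <:+ l) (h' : [x', y'] <:+ l) :
    x = x' ∧ y = y' := by
  have := List.suffix_of_suffix_length_le h h' (by simp)
  have := this.eq_of_length (by simp)
  simpa using this

theorem exists_prefix_pair {l : List V} (h : 2 ≤ l.length) : ∃ x y l', l = [x, y] ++ l' := by
  match l, h with
  | x :: y :: l', _ => exact ⟨x, y, l', rfl⟩

theorem exists_suffix_pair {l : List V} (h : 2 ≤ l.length) : ∃ x y l', l = l' ++ [x, y] := by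
  obtain ⟨x, y, l', h'⟩ := exists_prefix_pair (l := l.reverse) (by simpa using h)
  refine ⟨y, x, l'.reverse, ?_⟩
  rw [← List.reverse_inj, h']
  simp

/-! ### Connecting paths through the reservoir. -/

theorem ncard_lists_meeting_le [DecidableEq V] (S D : Finset V) (t : ℕ) (L : Set (List V))
    (hL : ∀ m ∈ L, m.length = t ∧ (∀ v ∈ m, v ∈ S) ∧ ∃ v ∈ m, v ∈ D) :
    (L.ncard : ℝ) ≤ (S.card : ℝ) ^ t - ((S \ D).card : ℝ) ^ t := by
  have h1 : L ⊆ ((Fintype.piFinset (fun _ : Fin t => S) \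
      Fintype.piFinset (fun _ : Fin t => S \ D)).image List.ofFn : Finset (List V)) := by
    intro m hm
    obtain ⟨hlen, hS, v, hv, hD⟩ := hL m hm
    subst hlen
    rw [mem_coe, mem_image]
    refine ⟨m.get, ?_, List.ofFn_get m⟩
    rw [mem_sdiff, Fintype.mem_piFinset, Fintype.mem_piFinset]
    refine ⟨fun i => hS _ (List.get_mem m i), fun h => ?_⟩
    obtain ⟨i, rfl⟩ := List.mem_iff_get.1 hv
    exact (mem_sdiff.1 (h i)).2 hD
  have h2 := Set.ncard_le_ncard h1 (finite_toSet _)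
  rw [Set.ncard_coe_finset] at h2
  have h3 := h2.trans card_image_le
  have hsub : Fintype.piFinset (fun _ : Fin t => S \ D) ⊆ Fintype.piFinset (fun _ : Fin t => S) :=
    Fintype.piFinset_subset _ _ fun _ => sdiff_subset
  have h4 := card_sdiff_add_card_eq_card hsub
  simp only [Fintype.card_piFinset, prod_const, card_univ, Fintype.card_fin] at h4
  have h5 : (L.ncard : ℝ) ≤ ((Fintype.piFinset (fun _ : Fin t => S) \
      Fintype.piFinset (fun _ : Fin t => S \ D)).card : ℝ) := by exact_mod_cast h3
  have h6 : (((Fintype.piFinset (fun _ : Fin t => S) \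
      Fintype.piFinset (fun _ : Fin t => S \ D)).card : ℝ)) + ((S \ D).card : ℝ) ^ t
      = (S.card : ℝ) ^ t := by exact_mod_cast h4
  linarith

/-- By Bernoulli's inequality at most `t |D| |S|^(t-1) ≤ θ |S|^t / 4` sequences meet `D`, fewer than
the number of available paths. -/
theorem exists_tightPath_avoiding [DecidableEq V] {H : Hypergraph V} {S D : Finset V}
    (hS : S.Nonempty)
    {t : ℕ} {x y z w : V} {θ : ℝ} (hθ : 0 < θ) (hD : 4 * t * (D.card : ℝ) ≤ θ * S.card)
    (hDS : D ⊆ S)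
    (hcount : θ * (S.card : ℝ) ^ t / 2 ≤ (numTightPaths H (S : Set V) t x y z w : ℝ)) :
    ∃ m : List V, m.length = t ∧ (∀ v ∈ m, v ∈ S ∧ v ∉ D) ∧
      IsTightPath H ([x, y] ++ m ++ [z, w]) := by
  by_contra! hcon
  have h1 := ncard_lists_meeting_le S D t {m : List V | m.length = t ∧ (∀ v ∈ m, v ∈ (S : Set V)) ∧
    IsTightPath H ([x, y] ++ m ++ [z, w])} (by
      rintro m ⟨h1, h2, h3⟩
      refine ⟨h1, h2, ?_⟩
      by_contra! h4
      exact hcon m h1 (fun v hv => ⟨h2 v hv, h4 v hv⟩) h3)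
  have hs : (0 : ℝ) < S.card := by exact_mod_cast hS.card_pos
  have hDS' : (D.card : ℝ) ≤ S.card := by exact_mod_cast card_le_card hDS
  have h2 : 1 - t * (D.card / S.card : ℝ) ≤ (1 - D.card / S.card : ℝ) ^ t := by
    have hle : (D.card / S.card : ℝ) ≤ 1 := (div_le_one hs).2 hDS'
    have := one_add_mul_le_pow (a := -(D.card / S.card : ℝ)) (by linarith) t
    rw [← sub_eq_add_neg] at this
    linarith
  have h3 : ((S \ D).card : ℝ) ^ t = (S.card : ℝ) ^ t * (1 - D.card / S.card : ℝ) ^ t := by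
    rw [← mul_pow, card_sdiff_of_subset hDS, Nat.cast_sub (card_le_card hDS)]
    congr 1
    field_simp
  have h4 : t * (D.card / S.card : ℝ) ≤ θ / 4 := by
    rw [← mul_div_assoc, div_le_iff₀ hs]; linarith
  have hp : 0 < (S.card : ℝ) ^ t := by positivity
  rw [h3] at h1
  have h5 : θ * (S.card : ℝ) ^ t / 2 ≤
      (S.card : ℝ) ^ t - (S.card : ℝ) ^ t * (1 - D.card / S.card : ℝ) ^ t := hcount.trans h1
  nlinarith [mul_le_mul_of_nonneg_left h2 hp.le, mul_le_mul_of_nonneg_left h4 hp.le,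
    mul_pos hθ hp]

/-- Pairs of property `C` that are disjoint are joined by tight paths with `t` internal vertices
taken from `S` outside any small enough subset `D`. -/
def Connects (H : Hypergraph V) (C : V → V → Prop) (S : Finset V) (t N : ℕ) : Prop :=
  ∀ D : Finset V, D ⊆ S → D.card ≤ N → ∀ x y z w, C x y → C z w →
    Disjoint ({x, y} : Set V) {z, w} →
    ∃ m : List V, m.length = t ∧ (∀ v ∈ m, v ∈ S ∧ v ∉ D) ∧ IsTightPath H ([x, y] ++ m ++ [z, w])

/-- Greedy concatenation, each time forbidding the reservoir vertices already used. The last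
alternative makes the final end-pair disjoint from `Q`, as is needed to close the path into a cycle.
-/
theorem exists_tightPath_through [DecidableEq V] {H : Hypergraph V} {C : V → V → Prop}
    {S : Finset V} {t N : ℕ} (hcon : Connects H C S t N) :
    ∀ (Ps : List (List V)) (Q : List V), IsTightPath H Q → (∀ x y, [x, y] <:+ Q → C x y) →
      (∀ p ∈ Ps, IsTightPath H p ∧ (∀ x y, [x, y] <+: p → C x y) ∧ (∀ x y, [x, y] <:+ p → C x y) ∧
        (∀ v ∈ p, v ∉ S) ∧ List.Disjoint Q p) → Ps.Pairwise List.Disjoint →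
      (Q.toFinset ∩ S).card + Ps.length * t ≤ N →
      ∃ Q', IsTightPath H Q' ∧ Q <+: Q' ∧ (∀ x y, [x, y] <:+ Q' → C x y) ∧
        (∀ p ∈ Ps, ∀ v ∈ p, v ∈ Q') ∧ (Q'.toFinset ∩ S).card ≤ (Q.toFinset ∩ S).card + Ps.length * t ∧
        ((Ps = [] ∧ Q' = Q) ∨ ∀ x y, [x, y] <:+ Q' → x ∉ Q ∧ y ∉ Q) := by
  intro Ps
  induction Ps with
  | nil =>
    intro Q hQ hC _ _ _
    exact ⟨Q, hQ, List.prefix_rfl, hC, by simp, by simp, by simp⟩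
  | cons p Ps ih =>
    intro Q hQ hC hPs hpw hN
    obtain ⟨hp, hpC, hpC', hpS, hpQ⟩ := hPs p (by simp)
    obtain ⟨x, y, Q₀, hQ₀⟩ := exists_suffix_pair hQ.1
    obtain ⟨z, w, p₀, hp₀⟩ := exists_prefix_pair hp.1
    have hxy : [x, y] <:+ Q := hQ₀ ▸ List.suffix_append _ _
    have hzw : [z, w] <+: p := hp₀ ▸ List.prefix_append _ _
    have hd : Disjoint ({x, y} : Set V) {z, w} := by
      rw [Set.disjoint_left]
      intro v h1 h2
      refine hpQ (a := v) (hxy.subset ?_) (hzw.subset ?_)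
      · simpa using h1
      · simpa using h2
    have hlen : (p :: Ps).length * t = Ps.length * t + t := by rw [List.length_cons]; ring
    obtain ⟨m, hm, hmS, hmp⟩ := hcon (Q.toFinset ∩ S) inter_subset_right (by omega) x y z w
      (hC x y hxy) (hpC z w hzw) hd
    have hmQ : List.Disjoint Q m := fun v h1 h2 => (hmS v h2).2 (by simp [h1, (hmS v h2).1])
    have hmp' : List.Disjoint m p := fun v h1 h2 => hpS v h2 (hmS v h1).1
    have hmn : m.Nodup := (List.nodup_append.1 (List.nodup_append.1 hmp.2.1).1).2.1
    set Q₁ := Q ++ m ++ p with hQ₁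
    have hQ₁t : IsTightPath H Q₁ := by
      refine ⟨by rw [hQ₁]; have := hQ.1; simp; omega, ?_, ?_⟩
      · rw [hQ₁]
        refine (hQ.2.1.append hmn hmQ).append hp.2.1 ?_
        intro v h1 h2
        rcases List.mem_append.1 h1 with h | h
        exacts [hpQ h h2, hmp' h h2]
      · have h1 : IsTightWalk H (Q₀ ++ [x, y] ++ (m ++ [z, w])) :=
          isTightWalk_append_pair (hQ₀ ▸ hQ.2.2) (by simpa using hmp.2.2)
        have h2 : IsTightWalk H ((Q₀ ++ [x, y] ++ m) ++ [z, w] ++ p₀) :=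
          isTightWalk_append_pair (by simpa using h1) (hp₀ ▸ hp.2.2)
        rw [hQ₁, hQ₀, hp₀]
        simpa using h2
    have hpQ₁ : p <:+ Q₁ := List.suffix_append _ _
    have hQQ₁ : Q <+: Q₁ := by rw [hQ₁, List.append_assoc]; exact List.prefix_append _ _
    have hend : ∀ a b, [a, b] <:+ Q₁ → [a, b] <:+ p := fun a b h =>
      List.suffix_of_suffix_length_le h hpQ₁ (by simpa using hp.1)
    have hcard : (Q₁.toFinset ∩ S).card ≤ (Q.toFinset ∩ S).card + t := by
      have : Q₁.toFinset ∩ S ⊆ (Q.toFinset ∩ S) ∪ m.toFinset := by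
        intro v hv
        simp only [hQ₁, List.toFinset_append, mem_inter, mem_union, List.mem_toFinset] at hv ⊢
        rcases hv with ⟨(h | h) | h, h'⟩
        · exact Or.inl ⟨h, h'⟩
        · exact Or.inr h
        · exact absurd h' (hpS v h)
      refine (card_le_card this).trans ((card_union_le _ _).trans ?_)
      have := m.toFinset_card_le
      omega
    rw [List.pairwise_cons] at hpw
    obtain ⟨Q', h1, h2, h3, h4, h5, h6⟩ := ih Q₁ hQ₁t (fun a b h => hpC' a b (hend a b h))
      (fun p' hp' => by
        obtain ⟨k1, k2, k3, k4, k5⟩ := hPs p' (by simp [hp'])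
        refine ⟨k1, k2, k3, k4, ?_⟩
        intro v hv hv'
        rw [hQ₁, List.mem_append, List.mem_append] at hv
        rcases hv with (h | h) | h
        · exact k5 h hv'
        · exact k4 v hv' (hmS v h).1
        · exact hpw.1 p' hp' h hv') hpw.2 (by omega)
    refine ⟨Q', h1, hQQ₁.trans h2, h3, ?_, by omega, ?_⟩
    · intro p' hp' v hv
      rcases List.mem_cons.1 hp' with rfl | h
      · exact h2.subset (hpQ₁.subset hv)
      · exact h4 p' h v hv
    · right
      intro a b hab
      rcases h6 with ⟨-, rfl⟩ | h6
      · have := hend a b hab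
        exact ⟨fun h => hpQ h (this.subset (by simp)), fun h => hpQ h (this.subset (by simp))⟩
      · obtain ⟨k1, k2⟩ := h6 a b hab
        exact ⟨fun h => k1 (hQQ₁.subset h), fun h => k2 (hQQ₁.subset h)⟩

theorem exists_tightCycle_through [DecidableEq V] {H : Hypergraph V} {C : V → V → Prop}
    {S : Finset V} {t N : ℕ} (hcon : Connects H C S t N) (Ps : List (List V)) (hne : Ps ≠ [])
    (P : List V) (hP : IsTightPath H P) (hPS : ∀ v ∈ P, v ∉ S)
    (hC : ∀ x y, [x, y] <:+ P → C x y) (hC' : ∀ x y, [x, y] <+: P → C x y)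
    (hPs : ∀ p ∈ Ps, IsTightPath H p ∧ (∀ x y, [x, y] <+: p → C x y) ∧
      (∀ x y, [x, y] <:+ p → C x y) ∧ (∀ v ∈ p, v ∉ S) ∧ List.Disjoint P p)
    (hpw : Ps.Pairwise List.Disjoint) (hN : Ps.length * t ≤ N) :
    ∃ c, IsTightCycle H c ∧ P <+: c ∧ ∀ p ∈ Ps, ∀ v ∈ p, v ∈ c := by
  have hP0 : P.toFinset ∩ S = ∅ := by
    rw [← disjoint_iff_inter_eq_empty, disjoint_left]
    intro v hv
    exact hPS v (List.mem_toFinset.1 hv)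
  obtain ⟨Q, hQ, hPQ, hQC, hQall, hQS, hQend⟩ := exists_tightPath_through hcon Ps P hP hC hPs hpw
    (by simpa [hP0] using hN)
  have hQend := hQend.resolve_left fun h => hne h.1
  obtain ⟨x, y, Q₀, hQ₀⟩ := exists_suffix_pair hQ.1
  obtain ⟨z, w, P₀, hP₀⟩ := exists_prefix_pair hP.1
  have hxy : [x, y] <:+ Q := hQ₀ ▸ List.suffix_append _ _
  have hzwP : [z, w] <+: P := hP₀ ▸ List.prefix_append _ _
  have hzw : [z, w] <+: Q := hzwP.trans hPQ
  obtain ⟨hx, hy⟩ := hQend x y hxy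
  have hz : z ∈ P := hzwP.subset (by simp)
  have hw : w ∈ P := hzwP.subset (by simp)
  have hd : Disjoint ({x, y} : Set V) {z, w} := by
    rw [Set.disjoint_left]
    rintro v (rfl | rfl) (rfl | rfl) <;> contradiction
  rw [hP0, card_empty, zero_add] at hQS
  obtain ⟨m, hm, hmS, hmp⟩ := hcon (Q.toFinset ∩ S) inter_subset_right (hQS.trans hN) x y z w
    (hQC x y hxy) (hC' z w hzwP) hd
  have hmQ : List.Disjoint Q m := fun v h1 h2 => (hmS v h2).2 (by simp [h1, (hmS v h2).1])
  have hmn : m.Nodup := (List.nodup_append.1 (List.nodup_append.1 hmp.2.1).1).2.1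
  refine ⟨Q ++ m, ⟨?_, hQ.2.1.append hmn hmQ, ?_⟩, hPQ.trans (List.prefix_append _ _),
    fun p hp v hv => List.mem_append.2 (Or.inl (hQall p hp v hv))⟩
  · have hsub : ({x, y} ∪ {z, w} : Finset V) ⊆ Q.toFinset := by
      intro v hv
      rw [List.mem_toFinset]
      simp only [mem_union, mem_insert, mem_singleton] at hv
      rcases hv with (rfl | rfl) | (rfl | rfl)
      exacts [hxy.subset (by simp), hxy.subset (by simp), hzw.subset (by simp), hzw.subset (by simp)]
    have hxyne : x ≠ y := by
      have := hxy.sublist.nodup hQ.2.1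
      simpa using this
    have hzwne : z ≠ w := by
      have := hzw.sublist.nodup hQ.2.1
      simpa using this
    have h1 := card_le_card hsub
    rw [card_union_of_disjoint, card_pair hxyne, card_pair hzwne,
      List.toFinset_card_of_nodup hQ.2.1] at h1
    · rw [List.length_append]; omega
    · rw [disjoint_left]
      simp only [mem_insert, mem_singleton]
      rintro v (rfl | rfl) (rfl | rfl) <;> contradiction
  · have htake : (Q ++ m).take 2 = [z, w] := by
      obtain ⟨Q₁, rfl⟩ := hzw
      simp
    rw [htake]
    have h1 : IsTightWalk H (Q₀ ++ [x, y] ++ (m ++ [z, w])) :=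
      isTightWalk_append_pair (hQ₀ ▸ hQ.2.2) (by simpa using hmp.2.2)
    rw [hQ₀]
    simpa using h1

end

/-! ### Families of new paths from a blown-up matching. -/

section

variable {V : Type*}

/-- Here `f j` lists the `k + 1` copies of the point `j`. Each matching edge receives its own `k`
vertices of `U` for the third positions, so distinct matching edges give disjoint zigzags. -/
theorem exists_zigzag_family [DecidableEq V] {J : Type*} [DecidableEq J] {H : Hypergraph V}
    {C : V → V → Prop} (k : ℕ) (𝓜 : Finset (J × J))
    (hdisj : (𝓜 : Set (J × J)).PairwiseDisjoint ends) (hne : ∀ p ∈ 𝓜, p.1 ≠ p.2)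
    (f : J → ℕ → V)
    (hf : ∀ i j s t, s ≤ k → t ≤ k → f i s = f j t → i = j ∧ s = t) (U : Finset V)
    (hU : 𝓜.card * k ≤ U.card) (hUf : ∀ j t, t ≤ k → f j t ∉ U)
    (hE : ∀ p ∈ 𝓜, ∀ u ∈ U, ∀ s t, s ≤ k → t ≤ k →
      ({u, f p.1 s, f p.2 t} : Set V) ∈ H.edgeSet)
    (hC : ∀ p ∈ 𝓜, ∀ s t, s ≤ k → t ≤ k → C (f p.1 s) (f p.2 t)) :
    ∃ new : Finset (List V), new.card = 𝓜.card ∧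
      (new : Set (List V)).PairwiseDisjoint List.toFinset ∧
      ∀ l ∈ new, IsTightPath H l ∧ l.length = 3 * k + 2 ∧ (∀ x y, [x, y] <+: l → C x y) ∧
        (∀ x y, [x, y] <:+ l → C x y) ∧ ∀ v ∈ l, v ∈ U ∨ ∃ j t, t ≤ k ∧ v = f j t := by
  obtain ⟨e⟩ : Nonempty (𝓜 × Fin k ↪ U) := by
    apply Function.Embedding.nonempty_of_card_le
    simpa using hU
  -- The value `f p.1 0` is a dummy: only `p ∈ 𝓜` and `i < k` are used.
  set υ : J × J → ℕ → V := fun p i =>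
    if h : p ∈ 𝓜 ∧ i < k then e (⟨p, h.1⟩, ⟨i, h.2⟩) else f p.1 0 with hυ
  have hυU : ∀ p ∈ 𝓜, ∀ i < k, υ p i ∈ U := by
    intro p hp i hi
    simp only [hυ, dif_pos (And.intro hp hi)]
    exact (e _).2
  have hυinj : ∀ p ∈ 𝓜, ∀ q ∈ 𝓜, ∀ i < k, ∀ j < k, υ p i = υ q j → p = q ∧ i = j := by
    intro p hp q hq i hi j hj h
    simp only [hυ, dif_pos (And.intro hp hi), dif_pos (And.intro hq hj)] at h
    have := e.injective (Subtype.ext h)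
    simpa using this
  set Z : J × J → List V := fun p => zigzag (f p.1) (f p.2) (υ p) k with hZ
  have hZmem : ∀ p ∈ 𝓜, ∀ v ∈ Z p, (∃ i < k, v = υ p i) ∨ ∃ j ∈ ends p, ∃ t ≤ k, v = f j t := by
    intro p _ v hv
    rcases mem_zigzag.1 hv with ⟨i, hi, h⟩ | ⟨i, hi, h⟩ | ⟨i, hi, h⟩
    · exact Or.inr ⟨p.1, by simp [ends], i, hi, h⟩
    · exact Or.inr ⟨p.2, by simp [ends], i, hi, h⟩
    · exact Or.inl ⟨i, hi, h⟩
  have hZdisj : ∀ p ∈ 𝓜, ∀ q ∈ 𝓜, p ≠ q → Disjoint (Z p).toFinset (Z q).toFinset := by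
    intro p hp q hq hpq
    rw [disjoint_left]
    intro v hv hv'
    rw [List.mem_toFinset] at hv hv'
    rcases hZmem p hp v hv with ⟨i, hi, h1⟩ | ⟨j, hj, t, ht, h1⟩ <;>
      rcases hZmem q hq v hv' with ⟨i', hi', h2⟩ | ⟨j', hj', t', ht', h2⟩
    · exact hpq (hυinj p hp q hq i hi i' hi' (h1.symm.trans h2)).1
    · exact hUf j' t' ht' (h2 ▸ h1 ▸ hυU p hp i hi)
    · exact hUf j t ht (h1 ▸ h2 ▸ hυU q hq i' hi')
    · have := (hf _ _ _ _ ht ht' (h1.symm.trans h2)).1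
      subst this
      exact disjoint_left.1 (hdisj hp hq hpq) hj hj'
  have hZne : ∀ p, (Z p).toFinset.Nonempty := fun p =>
    ⟨f p.1 0, List.mem_toFinset.2 (mem_zigzag.2 (Or.inl ⟨0, Nat.zero_le _, rfl⟩))⟩
  have hZinj : Set.InjOn Z 𝓜 := by
    intro p hp q hq h
    by_contra hpq
    have := hZdisj p hp q hq hpq
    rw [h, disjoint_self_iff_empty] at this
    exact (hZne q).ne_empty this
  refine ⟨𝓜.image Z, card_image_of_injOn hZinj, ?_, ?_⟩
  · intro l hl l' hl' hll
    obtain ⟨p, hp, rfl⟩ := mem_image.1 (mem_coe.1 hl)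
    obtain ⟨q, hq, rfl⟩ := mem_image.1 (mem_coe.1 hl')
    exact hZdisj p hp q hq fun h => hll (by rw [h])
  · intro l hl
    obtain ⟨p, hp, rfl⟩ := mem_image.1 hl
    refine ⟨?_, length_zigzag _ _ _ _, ?_, ?_, ?_⟩
    · refine isTightPath_zigzag ?_ ?_ ?_ ?_ ?_ ?_ ?_
      · intro i j l hi hj hl
        exact hE p hp _ (hυU p hp l hl) i j hi hj
      · exact fun i hi j hj h => (hf _ _ _ _ hi hj h).2
      · exact fun i hi j hj h => (hf _ _ _ _ hi hj h).2
      · exact fun i hi j hj h => (hυinj p hp p hp i hi j hj h).2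
      · exact fun i j hi hj h => hne p hp (hf _ _ _ _ hi hj h).1
      · exact fun i l hi hl h => hUf p.1 i hi (h ▸ hυU p hp l hl)
      · exact fun i l hi hl h => hUf p.2 i hi (h ▸ hυU p hp l hl)
    · intro x y hxy
      obtain ⟨rfl, rfl⟩ := prefix_pair_unique hxy (prefix_zigzag _ _ _ _)
      exact hC p hp 0 0 (Nat.zero_le _) (Nat.zero_le _)
    · intro x y hxy
      obtain ⟨l, hl⟩ := exists_zigzag_eq_append (f p.1) (f p.2) (υ p) k
      obtain ⟨rfl, rfl⟩ := suffix_pair_unique hxy (hl ▸ List.suffix_append _ _)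
      exact hC p hp k k le_rfl le_rfl
    · intro v hv
      rcases hZmem p hp v hv with ⟨i, hi, h⟩ | ⟨j, -, t, ht, h⟩
      · exact Or.inl (h ▸ hυU p hp i hi)
      · exact Or.inr ⟨j, t, ht, h⟩

/-! ### Connectable edges in the robust subgraphs. -/

theorem card_adjPairs [Fintype V] (G : SimpleGraph V) :
    (adjPairs G).card = 2 * G.edgeSet.ncard := by
  classical
  have h1 : G.edgeSet.ncard = G.edgeFinset.card := by
    rw [Set.ncard_eq_toFinset_card']; rfl
  rw [h1, ← G.sum_degrees_eq_twice_card_edges]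
  have h2 : (adjPairs G).card = ∑ x, ∑ y, if G.Adj x y then 1 else 0 := by
    rw [← Fintype.sum_prod_type', ← card_filter]
    congr 1
  rw [h2]
  refine sum_congr rfl fun x _ => ?_
  rw [← card_filter, ← G.card_neighborFinset_eq_degree]
  congr 1
  ext; simp

/-- The edges of `R u` that are `ζ`-connectable. -/
def connectableGraph [Fintype V] {H : Hypergraph V} (R : (v : V) → (link H v).Subgraph) (ζ : ℝ)
    (u : V) : SimpleGraph V where
  Adj x y := (R u).Adj x y ∧ IsConnectable R ζ x y
  symm := ⟨fun x y h => ⟨h.1.symm, by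
    unfold IsConnectable at *
    simp only [(R _).adj_comm y x]
    exact h.2⟩⟩
  loopless := ⟨fun _ h => h.1.ne rfl⟩

/-- The ordered pairs of adjacent vertices of `R u` that are not `ζ`-connectable. -/
noncomputable def lostPairs [Fintype V] {H : Hypergraph V} (R : (v : V) → (link H v).Subgraph)
    (ζ : ℝ) (u : V) : Finset (V × V) := by
  classical exact univ.filter fun p => (R u).Adj p.1 p.2 ∧ ¬ IsConnectable R ζ p.1 p.2

/-- Double counting: a pair that is not connectable is an edge of `R u` for fewer than `ζ n`
vertices `u`. -/
theorem sum_card_lostPairs_le [Fintype V] {H : Hypergraph V} (R : (v : V) → (link H v).Subgraph)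
    {ζ : ℝ} (hζ : 0 ≤ ζ) :
    ∑ u, ((lostPairs R ζ u).card : ℝ) ≤ ζ * (Fintype.card V : ℝ) ^ 3 := by
  classical
  have h1 : ∑ u, ((lostPairs R ζ u).card : ℝ) = ∑ p : V × V, ∑ u,
      if (R u).Adj p.1 p.2 ∧ ¬ IsConnectable R ζ p.1 p.2 then (1 : ℝ) else 0 := by
    rw [sum_comm]
    refine sum_congr rfl fun u _ => ?_
    rw [sum_boole, lostPairs]
  rw [h1]
  calc _ ≤ ∑ _p : V × V, ζ * (Fintype.card V : ℝ) := by
        refine sum_le_sum fun p _ => ?_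
        by_cases hp : IsConnectable R ζ p.1 p.2
        · simp only [hp, not_true, and_false, if_false, sum_const_zero]
          positivity
        · simp only [hp, not_false_iff, and_true]
          unfold IsConnectable at hp
          push Not at hp
          rw [sum_boole]
          refine le_trans (le_of_eq ?_) hp.le
          rw [Set.ncard_eq_toFinset_card']
          congr 2
          ext; simp
    _ = _ := by
        rw [sum_const, card_univ, Fintype.card_prod, nsmul_eq_mul]; push_cast; ring

theorem card_adjPairs_connectableGraph_ge [Fintype V] {H : Hypergraph V}
    (R : (v : V) → (link H v).Subgraph) (ζ : ℝ) (u : V) :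
    2 * ((R u).edgeSet.ncard : ℝ) ≤ (adjPairs (connectableGraph R ζ u)).card
      + (lostPairs R ζ u).card := by
  classical
  have h1 := card_adjPairs (R u).spanningCoe
  rw [SimpleGraph.Subgraph.edgeSet_spanningCoe] at h1
  have h2 : adjPairs (R u).spanningCoe ⊆ adjPairs (connectableGraph R ζ u) ∪ lostPairs R ζ u := by
    intro p hp
    rw [mem_adjPairs] at hp
    have hp' : (R u).Adj p.1 p.2 := hp
    rw [mem_union, mem_adjPairs, lostPairs, mem_filter]
    by_cases h : IsConnectable R ζ p.1 p.2
    · exact Or.inl ⟨hp', h⟩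
    · exact Or.inr ⟨mem_univ _, hp', h⟩
  have h3 := (card_le_card h2).trans (card_union_le _ _)
  rw [h1] at h3
  exact_mod_cast h3

/-- Markov's inequality; the bound on `ζ` leaves at most `θ² n / 2` vertices with too many lost
pairs. -/
theorem card_filter_lostPairs_ge [Fintype V] {H : Hypergraph V}
    (R : (v : V) → (link H v).Subgraph) {ζ α θ : ℝ} (hα : 0 < α) (hζ0 : 0 ≤ ζ)
    (hζ : ζ ≤ α * θ ^ 2 / 16) (hV : 0 < Fintype.card V) (U : Finset V)
    (hU : θ ^ 2 * Fintype.card V ≤ U.card) :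
    ∃ U' ⊆ U, θ ^ 2 / 2 * Fintype.card V ≤ U'.card ∧
      ∀ u ∈ U', ((lostPairs R ζ u).card : ℝ) ≤ α / 8 * (Fintype.card V : ℝ) ^ 2 := by
  classical
  set n : ℝ := (Fintype.card V : ℝ) with hn
  have hn0 : 0 < n := Nat.cast_pos.2 hV
  refine ⟨U.filter fun u => ((lostPairs R ζ u).card : ℝ) ≤ α / 8 * n ^ 2, filter_subset _ _, ?_,
    fun u hu => (mem_filter.1 hu).2⟩
  set B := U.filter fun u => ¬ ((lostPairs R ζ u).card : ℝ) ≤ α / 8 * n ^ 2 with hB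
  have h1 : B.card * (α / 8 * n ^ 2) ≤ ζ * n ^ 3 := by
    calc B.card * (α / 8 * n ^ 2) = ∑ _u ∈ B, α / 8 * n ^ 2 := by rw [sum_const, nsmul_eq_mul]
      _ ≤ ∑ u ∈ B, ((lostPairs R ζ u).card : ℝ) :=
          sum_le_sum fun u hu => (not_le.1 (mem_filter.1 hu).2).le
      _ ≤ ∑ u, ((lostPairs R ζ u).card : ℝ) :=
          sum_le_sum_of_subset_of_nonneg (subset_univ _) fun _ _ _ => by positivity
      _ ≤ _ := sum_card_lostPairs_le R hζ0
  have h2 : (B.card : ℝ) ≤ θ ^ 2 / 2 * n := by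
    have h3 : ζ * n ^ 3 ≤ (θ ^ 2 / 2 * n) * (α / 8 * n ^ 2) := by
      have := mul_le_mul_of_nonneg_right hζ (by positivity : 0 ≤ n ^ 3)
      linarith
    exact le_of_mul_le_mul_right (h1.trans h3) (by positivity)
  have h4 : ((U.filter fun u => ((lostPairs R ζ u).card : ℝ) ≤ α / 8 * n ^ 2).card : ℝ) + B.card
      = U.card := by exact_mod_cast card_filter_add_card_filter_not _
  linarith

end

/-! ### A maximum family of segments covers almost everything. -/

/-- A tight path on `M` vertices avoiding `S` and `P` with connectable end-pairs. -/
structure IsSegment {V : Type*} (H : Hypergraph V) (C : V → V → Prop) (S : Finset V) (P : List V)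
    (M : ℕ) (l : List V) : Prop where
  tightPath : IsTightPath H l
  length_eq : l.length = M
  avoids : ∀ v ∈ l, v ∉ S ∧ v ∉ P
  start : ∀ x y, [x, y] <+: l → C x y
  finish : ∀ x y, [x, y] <:+ l → C x y

theorem IsSegment.toFinset_nonempty {V : Type*} [DecidableEq V] {H : Hypergraph V}
    {C : V → V → Prop} {S : Finset V} {P : List V} {M : ℕ} {l : List V}
    (h : IsSegment H C S P M l) : l.toFinset.Nonempty := by
  rw [List.toFinset_nonempty_iff]
  rintro rfl
  exact absurd h.tightPath.1 (by simp)

/-- A family of disjoint lists of length `M` and a set disjoint from them are cut into blocks of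
size `M`, with less than `M` vertices left over. -/
theorem exists_blocks {V : Type u} [DecidableEq V] (𝒞 : Finset (List V)) {M : ℕ} (hM : 0 < M)
    (hlen : ∀ c ∈ 𝒞, c.length = M) (hnd : ∀ c ∈ 𝒞, c.Nodup)
    (hdisj : (𝒞 : Set (List V)).PairwiseDisjoint List.toFinset) (U : Finset V)
    (hU : ∀ c ∈ 𝒞, Disjoint c.toFinset U) :
    ∃ (Y : Type u) (_ : Fintype Y) (β : (𝒞 ⊕ Y) × Fin M → V), Function.Injective β ∧
      (∀ c a, β (Sum.inl c, a) ∈ c.1) ∧ (∀ y a, β (Sum.inr y, a) ∈ U) ∧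
      𝒞.card * M + U.card ≤ Fintype.card (𝒞 ⊕ Y) * M + M := by
  -- `ULift` places the extra blocks in the universe of `V`, as the box lemma requires.
  obtain ⟨e⟩ : Nonempty (ULift.{u} (Fin (U.card / M)) × Fin M ↪ U) := by
    apply Function.Embedding.nonempty_of_card_le
    simpa using Nat.div_mul_le_self U.card M
  refine ⟨ULift (Fin (U.card / M)), inferInstance, fun p => match p with
    | (Sum.inl c, a) => c.1.get (a.cast (hlen c c.2).symm)
    | (Sum.inr y, a) => (e (y, a)).1, ?_, fun c a => List.get_mem _ _, fun y a => (e (y, a)).2, ?_⟩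
  · rintro ⟨c | y, a⟩ ⟨c' | y', a'⟩ h
    · by_cases hc : c = c'
      · subst hc
        have := (List.nodup_iff_injective_get.1 (hnd c c.2)) h
        simpa using this
      · exfalso
        refine disjoint_left.1 (hdisj c.2 c'.2 fun h => hc (Subtype.ext h))
          (List.mem_toFinset.2 (List.get_mem c.1 (a.cast (hlen c c.2).symm))) ?_
        rw [List.mem_toFinset]
        have h' : c.1.get (a.cast (hlen c c.2).symm) = c'.1.get (a'.cast (hlen c' c'.2).symm) := h
        rw [h']
        exact List.get_mem _ _
    · exfalso
      have h' : c.1.get (a.cast (hlen c c.2).symm) = (e (y', a')).1 := h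
      exact disjoint_left.1 (hU c c.2) (List.mem_toFinset.2 (List.get_mem _ _))
        (h' ▸ (e (y', a')).2)
    · exfalso
      have h' : (e (y, a)).1 = c'.1.get (a'.cast (hlen c' c'.2).symm) := h
      exact disjoint_left.1 (hU c' c'.2) (List.mem_toFinset.2 (List.get_mem _ _))
        (h' ▸ (e (y, a)).2)
    · have := e.injective (Subtype.ext h)
      simpa using this
  · simp only [Fintype.card_sum, Fintype.card_coe, Fintype.card_ulift, Fintype.card_fin]
    have := Nat.div_add_mod U.card M
    have := Nat.mod_lt U.card hM
    nlinarith

/-- If too much is uncovered, the blown-up matching replaces at most `m (k + 1)` segments by `m (k +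
1) + 1` new ones. -/
theorem card_uncovered_le {V : Type u} [Fintype V] [DecidableEq V] {H : Hypergraph V}
    {R : (v : V) → (link H v).Subgraph} {α β ζ θ : ℝ} {ℓ : ℕ} (hα : 0 < α)
    (hR : ∀ v, IsRobustSubgraph (R v) α β ℓ) (hζ0 : 0 ≤ ζ) (hζ : ζ ≤ α * θ ^ 2 / 16)
    (hθ0 : 0 < θ) (hθ1 : θ ≤ 1) (hθα : θ ≤ α / 128)
    {S : Finset V} (hS : (S.card : ℝ) ≤ θ ^ 2 * Fintype.card V)
    {P : List V} (hP : (P.length : ℝ) ≤ θ * Fintype.card V) {k m : ℕ}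
    (hk : 64 / α ≤ k) (hm : 8 * (1 + 16 / α ^ 2) / α ≤ m) (hm2 : 2 ≤ m)
    (hn1 : 64 / α * (3 * k + 2 : ℕ) ≤ Fintype.card V)
    (hn2 : 4 * (3 * k + 2 : ℕ) * ((m * (k + 1) : ℕ) : ℝ) ^ 2
      < blowupDensity α k m * Fintype.card V)
    (hn3 : (((m * (k + 1) + 1) * k + m * (3 * k + 2) * (k + 1) : ℕ) : ℝ)
      < blowupDensity α k m / 2 * (θ ^ 2 / 2 * Fintype.card V))
    {𝒞 : Finset (List V)}
    (h𝒞 : IsMaxPacking List.toFinset (IsSegment H (IsConnectable R ζ) S P (3 * k + 2)) 𝒞) :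
    ((univ \ (S ∪ P.toFinset ∪ 𝒞.biUnion List.toFinset)).card : ℝ) ≤ θ ^ 2 * Fintype.card V := by
  classical
  set M : ℕ := 3 * k + 2 with hM
  set U := univ \ (S ∪ P.toFinset ∪ 𝒞.biUnion List.toFinset) with hU
  set D := blowupDensity α k m with hDdef
  have hD0 : 0 < D := blowupDensity_pos hα k m
  by_contra! hcon
  have hmemU : ∀ v ∈ U, v ∉ S ∧ v ∉ P ∧ ∀ c ∈ 𝒞, v ∉ c := by
    intro v hv
    rw [hU, mem_sdiff] at hv
    simp only [mem_union, List.mem_toFinset, mem_biUnion, not_or, not_exists, not_and] at hv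
    exact ⟨hv.2.1.1, hv.2.1.2, hv.2.2⟩
  have hV : 0 < Fintype.card V := by
    have : 0 < U.card := by
      have h0 : 0 ≤ θ ^ 2 * (Fintype.card V : ℝ) := by positivity
      exact_mod_cast h0.trans_lt hcon
    obtain ⟨v, -⟩ := card_pos.1 this
    exact Fintype.card_pos_iff.2 ⟨v⟩
  have hM0 : (0 : ℝ) < M := by rw [hM]; positivity
  set A : V → Finset V := fun u => univ.filter fun x => x ∈ (R u).verts with hA
  have hAcard : ∀ u, ((R u).verts.ncard : ℝ) = (A u).card := by
    intro u
    rw [Set.ncard_eq_toFinset_card']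
    congr 2
    ext; simp [hA]
  obtain ⟨n, hn⟩ : ∃ n : ℝ, n = Fintype.card V := ⟨_, rfl⟩
  have hn0 : 0 < n := hn ▸ Nat.cast_pos.2 hV
  -- Forced by `(2/3 + α/2) n ≤ |V(R v)| ≤ n`.
  have hα' : α ≤ 2 / 3 := by
    obtain ⟨v⟩ := Fintype.card_pos_iff.1 hV
    have h1 := (hR v).card_verts
    have h2 : ((A v).card : ℝ) ≤ n := by rw [hn]; exact_mod_cast card_le_univ _
    rw [hAcard, ← hn] at h1
    by_contra! h
    nlinarith
  obtain ⟨U₁, hU₁U, hU₁card, hU₁⟩ := card_filter_lostPairs_ge R hα hζ0 hζ hV U hcon.le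
  rw [← hn] at hU₁card hn1 hn2 hn3 hS hP hcon
  have hUdisj : ∀ c ∈ 𝒞, Disjoint c.toFinset U := by
    intro c hc
    rw [disjoint_right]
    intro v hv hvc
    exact (hmemU v hv).2.2 c hc (List.mem_toFinset.1 hvc)
  obtain ⟨Y, _, b, hbinj, hbl, hbr, hbcard⟩ := exists_blocks 𝒞 (M := M) (by omega)
    (fun c hc => (h𝒞.isGood c hc).length_eq) (fun c hc => (h𝒞.isGood c hc).tightPath.2.1)
    h𝒞.disj U hUdisj
  -- The blocks omit `S`, `P` and fewer than `M` leftover vertices, at most `α/128 + α/128 + α/64 =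
  -- α/32` of all vertices.
  have hcover : (1 - α / 32) * n ≤ Fintype.card (𝒞 ⊕ Y) * (M : ℝ) := by
    have h1 : (𝒞.biUnion List.toFinset).card = 𝒞.card * M := by
      rw [card_biUnion h𝒞.disj, sum_congr rfl fun c hc => ?_, sum_const, smul_eq_mul]
      rw [List.toFinset_card_of_nodup (h𝒞.isGood c hc).tightPath.2.1, (h𝒞.isGood c hc).length_eq]
    have h2 : Fintype.card V ≤ S.card + P.length + 𝒞.card * M + U.card := by
      have e1 : (univ : Finset V) ⊆ (S ∪ P.toFinset ∪ 𝒞.biUnion List.toFinset) ∪ U := by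
        rw [hU, union_sdiff_of_subset (subset_univ _)]
      have e2 := card_le_card e1
      have e3 := card_union_le (S ∪ P.toFinset ∪ 𝒞.biUnion List.toFinset) U
      have e4 := card_union_le (S ∪ P.toFinset) (𝒞.biUnion List.toFinset)
      have e5 := card_union_le S P.toFinset
      have e6 := P.toFinset_card_le
      rw [card_univ] at e2
      omega
    have h3 : Fintype.card V ≤ S.card + P.length + (Fintype.card (𝒞 ⊕ Y) * M + M) := by omega
    have h4 : n ≤ S.card + P.length + (Fintype.card (𝒞 ⊕ Y) * M + M) := by
      rw [hn]; exact_mod_cast h3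
    have h5 : (M : ℝ) ≤ α / 64 * n := by
      have : 64 / α * M * (α / 64) ≤ n * (α / 64) :=
        mul_le_mul_of_nonneg_right hn1 (by positivity)
      have e : 64 / α * (M : ℝ) * (α / 64) = M := by field_simp
      linarith
    have h6 : θ ^ 2 * n ≤ α / 128 * n := by
      apply mul_le_mul_of_nonneg_right _ hn0.le
      nlinarith
    have h7 : θ * n ≤ α / 128 * n := mul_le_mul_of_nonneg_right hθα hn0.le
    linarith
  have hXcard : 2 * ((m * (k + 1) : ℕ) : ℝ) ^ 2 < D * Fintype.card (𝒞 ⊕ Y) := by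
    have h1 : n / 2 ≤ Fintype.card (𝒞 ⊕ Y) * (M : ℝ) := by
      refine le_trans ?_ hcover
      nlinarith
    have h2 : M * (2 * ((m * (k + 1) : ℕ) : ℝ) ^ 2) < M * (D * Fintype.card (𝒞 ⊕ Y)) := by
      have := mul_le_mul_of_nonneg_left h1 hD0.le
      linarith
    exact lt_of_mul_lt_mul_left h2 hM0.le
  have hU₁pos : (0 : ℝ) < U₁.card := lt_of_lt_of_le (by positivity) hU₁card
  have hU₁ne : U₁.Nonempty := card_pos.1 (by exact_mod_cast hU₁pos)
  obtain ⟨g, 𝓜, U₂, hg, h𝓜disj, h𝓜ne, h𝓜card, hU₂U₁, hU₂card, hadj⟩ :=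
    exists_common_blowup (fun u => connectableGraph R ζ u) A U₁ hU₁ne
    (fun u x y h => by
      rw [hA, mem_filter]
      exact ⟨mem_univ _, h.1.fst_mem⟩) k b hbinj hα hα'
    (fun u hu => by rw [← hAcard]; exact (hR u).card_verts)
    (fun u hu => by
      have h1 := (hR u).edges_in
      have h2 := card_adjPairs_connectableGraph_ge R ζ u
      have h3 := hU₁ u hu
      rw [hAcard] at h1
      linarith) (by rw [← hn]; exact hcover) hk hm hm2 hXcard
  -- One edge more than the number of blocks suffices, and a fixed size bounds the number of common
  -- vertices needed.
  obtain ⟨𝓜', h𝓜', h𝓜'card⟩ := exists_subset_card_eq (Nat.succ_le_of_lt h𝓜card)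
  -- `Fin.ofNat (k + 1) t` is `t` for all `t ≤ k`; larger arguments play no role.
  set f : Fin m × Fin M → ℕ → V := fun j t => b (g j.1 (Fin.ofNat (k + 1) t), j.2) with hf
  have hfinj : ∀ i j s t, s ≤ k → t ≤ k → f i s = f j t → i = j ∧ s = t := by
    intro i j s t hs ht h
    have h1 := hbinj h
    rw [Prod.mk.injEq] at h1
    have h2 := @hg (i.1, Fin.ofNat (k + 1) s) (j.1, Fin.ofNat (k + 1) t) h1.1
    rw [Prod.mk.injEq, Fin.ext_iff] at h2
    simp only [Fin.ofNat, Nat.mod_eq_of_lt (Nat.lt_succ_of_le hs),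
      Nat.mod_eq_of_lt (Nat.lt_succ_of_le ht)] at h2
    exact ⟨Prod.ext (Fin.ext h2.1) h1.2, Fin.mk.inj h2.2⟩
  -- Blocks cut from `U` may contain vertices of `U₂`; removing all vertices of the chosen blocks
  -- keeps the third positions disjoint from them.
  set VS : Finset V := univ.image fun p : (Fin m × Fin M) × Fin (k + 1) => b (g p.1.1 p.2, p.1.2)
    with hVS
  have hVScard : VS.card ≤ m * M * (k + 1) := by
    refine card_image_le.trans ?_
    simp [card_univ]
  have hfVS : ∀ j t, f j t ∈ VS := fun j t => mem_image.2 ⟨(j, Fin.ofNat (k + 1) t), mem_univ _, rfl⟩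
  have hU₂big : (m * (k + 1) + 1) * k + m * M * (k + 1) < U₂.card := by
    have h1 := mul_le_mul_of_nonneg_left hU₁card (by positivity : 0 ≤ D / 2)
    have h2 := hn3.trans_le (h1.trans hU₂card)
    exact_mod_cast h2
  have hU₂sub : ∀ u ∈ U₂ \ VS, u ∈ U := fun u hu => hU₁U (hU₂U₁ (mem_sdiff.1 hu).1)
  obtain ⟨u₀, hu₀⟩ : U₂.Nonempty := card_pos.1 (by omega)
  obtain ⟨new, hnewcard, hnewdisj, hnew⟩ := exists_zigzag_family (H := H)
    (C := IsConnectable R ζ) k 𝓜'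
    (h𝓜disj.subset (by exact_mod_cast h𝓜')) (fun p hp h => h𝓜ne p (h𝓜' hp) (by rw [h])) f hfinj
    (U₂ \ VS) (by
      have := le_card_sdiff VS U₂
      rw [h𝓜'card]
      have e : (m * (k + 1)).succ * k = (m * (k + 1) + 1) * k := rfl
      omega)
    (fun j t _ h => (mem_sdiff.1 h).2 (hfVS j t))
    (fun p hp u hu s t _ _ => ((R u).adj_sub
      (hadj p (h𝓜' hp) u (mem_sdiff.1 hu).1 (Fin.ofNat (k + 1) s) (Fin.ofNat (k + 1) t)).1).2)
    (fun p hp s t _ _ => (hadj p (h𝓜' hp) u₀ hu₀ _ _).2)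
  have hbavoid : ∀ x a, b (x, a) ∉ S ∧ b (x, a) ∉ P := by
    rintro (c | y) a
    · exact (h𝒞.isGood c c.2).avoids _ (hbl c a)
    · exact ⟨(hmemU _ (hbr y a)).1, (hmemU _ (hbr y a)).2.1⟩
  -- The segments that occur among the `m (k + 1)` chosen blocks; no other segment meets a new path.
  set old : Finset (List V) := 𝒞.filter fun c => ∃ p : Fin m × Fin (k + 1), ∃ h : c ∈ 𝒞,
    g p.1 p.2 = Sum.inl ⟨c, h⟩ with hold
  have holdcard : old.card ≤ m * (k + 1) := by
    have : old ⊆ (univ : Finset (Fin m × Fin (k + 1))).image fun p =>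
        match g p.1 p.2 with
        | Sum.inl c => c.1
        | Sum.inr _ => [] := by
      intro c hc
      obtain ⟨-, p, h, hp⟩ := mem_filter.1 hc
      refine mem_image.2 ⟨p, mem_univ _, ?_⟩
      rw [hp]
    refine (card_le_card this).trans (card_image_le.trans ?_)
    simp [card_univ]
  have hexch := h𝒞.exchange (fun l hl => hl.toFinset_nonempty) old new (filter_subset _ _)
    ⟨fun l hl => by
      obtain ⟨h1, h2, h3, h4, h5⟩ := hnew l hl
      refine ⟨h1, h2, ?_, h3, h4⟩
      intro v hv
      rcases h5 v hv with h | ⟨j, t, -, rfl⟩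
      · exact ⟨(hmemU v (hU₂sub v h)).1, (hmemU v (hU₂sub v h)).2.1⟩
      · exact hbavoid _ _, hnewdisj⟩ (by
      intro l hl c hc
      obtain ⟨hc1, hc2⟩ := mem_sdiff.1 hc
      rw [disjoint_left]
      intro v hv hvc
      rw [List.mem_toFinset] at hv hvc
      rcases (hnew l hl).2.2.2.2 v hv with h | ⟨j, t, -, rfl⟩
      · exact (hmemU v (hU₂sub v h)).2.2 c hc1 hvc
      · simp only [hf] at hvc
        rcases hx : g j.1 (Fin.ofNat (k + 1) t) with c' | y
        · rw [hx] at hvc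
          by_cases hcc : c'.1 = c
          · refine hc2 (mem_filter.2 ⟨hc1, (j.1, Fin.ofNat (k + 1) t), hc1, ?_⟩)
            rw [hx]
            congr 1
            exact Subtype.ext hcc
          · exact disjoint_left.1 (h𝒞.disj c'.2 hc1 hcc) (List.mem_toFinset.2 (hbl c' j.2))
              (List.mem_toFinset.2 hvc)
        · rw [hx] at hvc
          exact (hmemU _ (hbr y j.2)).2.2 c hc1 hvc)
  rw [hnewcard, h𝓜'card] at hexch
  omega

end TightHam

/-! ### Choice of constants and assembly of the cycle. -/

open Finset in
theorem mainTheorem7 (α β : ℝ) (hα : 0 < α) (hβ : 0 < β) (ℓ : ℕ) (hℓ : 3 ≤ ℓ) (hodd : Odd ℓ)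
    (ζ₁ : ℝ) (hζ₁ : 0 < ζ₁) :
    ∃ θ₁_max : ℝ, 0 < θ₁_max ∧ ∀ θ₁ : ℝ, 0 < θ₁ → θ₁ ≤ θ₁_max →
    ∃ ζ₂_max : ℝ, 0 < ζ₂_max ∧ ∀ ζ₂ : ℝ, 0 < ζ₂ → ζ₂ ≤ ζ₂_max →
    ∃ θ₂_max : ℝ, 0 < θ₂_max ∧ ∀ θ₂ : ℝ, 0 < θ₂ → θ₂ ≤ θ₂_max →
    ∃ n₀ : ℕ, ∀ (V : Type*) [Fintype V] (H : Hypergraph V),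
      n₀ ≤ Fintype.card V →
      TightHam.IsThreeUniform H →
      (∀ v : V, (5 / 9 + α) * ((Fintype.card V : ℝ) ^ 2 / 2) ≤ (TightHam.degree H v : ℝ)) →
      ∀ R : (v : V) → (TightHam.link H v).Subgraph,
      (∀ v : V, TightHam.IsRobustSubgraph (R v) α β ℓ) →
      ∀ S : Finset V, TightHam.IsReservoir R ℓ θ₁ ζ₂ θ₂ S →
      ∀ P : List V, TightHam.IsAbsorbingPath R ζ₁ θ₁ S P →
      ∃ C : List V, TightHam.IsTightCycle H C ∧ P <+: C ∧
        (1 - 2 * θ₁ ^ 2) * (Fintype.card V : ℝ) ≤ (C.length : ℝ) := by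
  -- The bound `1/4` ensures that `S`, `P` and the uncovered set cannot exhaust `V`, so `𝒞` is
  -- nonempty; `α / 128` makes the blocks cover enough.
  refine ⟨min (1 / 4) (α / 128), by positivity, fun θ hθ0 hθ => ?_⟩
  obtain ⟨hθ4, hθα⟩ := le_min_iff.1 hθ
  refine ⟨min ζ₁ (α * θ ^ 2 / 16), by positivity, fun ζ hζ0 hζ => ?_⟩
  obtain ⟨hζζ₁, hζα⟩ := le_min_iff.1 hζ
  refine ⟨1, one_pos, fun θ₂ hθ₂0 _ => ?_⟩
  set t : ℕ := 3 * ℓ + 1 with ht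
  -- The second bound keeps the connections cheap: they use at most `t n / k` vertices of the
  -- reservoir, and `4t · t n / k ≤ θ₂ θ² n / 2 ≤ θ₂ |S|`.
  obtain ⟨k, hk⟩ := exists_nat_ge (max (64 / α) (8 * (t : ℝ) ^ 2 / (θ₂ * θ ^ 2)))
  obtain ⟨hkα, hkt⟩ := max_le_iff.1 hk
  obtain ⟨m, hm'⟩ := exists_nat_ge (max (8 * (1 + 16 / α ^ 2) / α) 2)
  obtain ⟨hm, hm2⟩ := max_le_iff.1 hm'
  have hm2 : 2 ≤ m := by exact_mod_cast hm2
  have hD0 := TightHam.blowupDensity_pos hα k m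
  set D := TightHam.blowupDensity α k m with hD
  -- Three demands on `n`: the leftover of the block partition is negligible, there are enough
  -- blocks for an injective box, and the common vertices suffice for all zigzags.
  obtain ⟨n₀, hn₀⟩ := exists_nat_gt (max (max (64 / α * (3 * k + 2 : ℕ))
    (4 * (3 * k + 2 : ℕ) * ((m * (k + 1) : ℕ) : ℝ) ^ 2 / D)) ((((m * (k + 1) + 1) * k
      + m * (3 * k + 2) * (k + 1) : ℕ) : ℝ) / (D / 2 * (θ ^ 2 / 2))))
  obtain ⟨hn₀', hn3⟩ := max_lt_iff.1 hn₀
  obtain ⟨hn1, hn2⟩ := max_lt_iff.1 hn₀'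
  refine ⟨n₀, fun V _ H hV _ _ R hR S hS P hP => ?_⟩
  classical
  have hVn : (n₀ : ℝ) ≤ Fintype.card V := by exact_mod_cast hV
  replace hn1 := (hn1.trans_le hVn).le
  replace hn2 := hn2.trans_le hVn
  replace hn3 := hn3.trans_le hVn
  rw [div_lt_iff₀ hD0] at hn2
  rw [div_lt_iff₀ (by positivity)] at hn3
  replace hn3 : (((m * (k + 1) + 1) * k + m * (3 * k + 2) * (k + 1) : ℕ) : ℝ)
      < D / 2 * (θ ^ 2 / 2 * Fintype.card V) := hn3.trans_eq (by ring)
  obtain ⟨𝒞, h𝒞⟩ := TightHam.exists_isMaxPacking List.toFinset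
    (TightHam.IsSegment H (TightHam.IsConnectable R ζ) S P (3 * k + 2))
    (fun l hl => hl.toFinset_nonempty)
  have hunc := TightHam.card_uncovered_le hα hR hζ0.le hζα hθ0 (by linarith) hθα hS.card_upper
    hP.card_le hkα hm hm2 hn1 (hn2.trans_eq (mul_comm _ _)) hn3 h𝒞
  obtain ⟨n, hn⟩ : ∃ n : ℝ, n = Fintype.card V := ⟨_, rfl⟩
  have hn0 : 0 < n := by
    rw [hn]
    refine lt_of_lt_of_le ?_ hn1
    positivity
  have hScard := hS.card_upper
  have hScard' := hS.card_lower
  have hPcard := hP.card_le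
  rw [← hn] at hunc hScard hScard' hPcard
  have hSne : S.Nonempty := by
    rw [← card_pos]
    have : (0 : ℝ) < S.card := lt_of_lt_of_le (by positivity) hScard'
    exact_mod_cast this
  have hbU : (𝒞.biUnion List.toFinset).card = 𝒞.card * (3 * k + 2) := by
    rw [card_biUnion h𝒞.disj, sum_congr rfl fun c hc => ?_, sum_const, smul_eq_mul]
    rw [List.toFinset_card_of_nodup (h𝒞.isGood c hc).tightPath.2.1, (h𝒞.isGood c hc).length_eq]
  have hcov : n ≤ S.card + (P.toFinset ∪ 𝒞.biUnion List.toFinset).card + θ ^ 2 * n := by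
    have e1 : (univ : Finset V) ⊆ (S ∪ P.toFinset ∪ 𝒞.biUnion List.toFinset)
        ∪ (univ \ (S ∪ P.toFinset ∪ 𝒞.biUnion List.toFinset)) := by
      rw [union_sdiff_of_subset (subset_univ _)]
    have e2 := (card_le_card e1).trans (card_union_le _ _)
    rw [union_assoc] at e2
    have e3 := card_union_le S (P.toFinset ∪ 𝒞.biUnion List.toFinset)
    rw [card_univ, ← union_assoc] at e2
    have e4 : n ≤ S.card + (P.toFinset ∪ 𝒞.biUnion List.toFinset).card
        + (univ \ (S ∪ P.toFinset ∪ 𝒞.biUnion List.toFinset)).card := by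
      rw [hn]; rw [union_assoc] at e2 ⊢; exact_mod_cast e2.trans (Nat.add_le_add_right e3 _)
    linarith
  have h𝒞ne : 𝒞.toList ≠ [] := by
    intro h
    rw [toList_eq_nil] at h
    rw [h, biUnion_empty, union_empty] at hcov
    have h1 : (P.toFinset.card : ℝ) ≤ θ * n := by
      refine le_trans ?_ hPcard
      exact_mod_cast P.toFinset_card_le
    have h2 : θ ^ 2 ≤ 1 / 16 := by nlinarith
    have h3 : θ ^ 2 * n ≤ 1 / 16 * n := mul_le_mul_of_nonneg_right h2 hn0.le
    have h4 : θ * n ≤ 1 / 4 * n := mul_le_mul_of_nonneg_right hθ4 hn0.le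
    linarith
  have hmono : ∀ x y, TightHam.IsConnectable R ζ₁ x y → TightHam.IsConnectable R ζ x y := by
    intro x y h
    exact (mul_le_mul_of_nonneg_right hζζ₁ (by positivity)).trans h
  have hcon : TightHam.Connects H (TightHam.IsConnectable R ζ) S t (𝒞.toList.length * t) := by
    intro E hES hE x y z w hxy hzw hd
    refine TightHam.exists_tightPath_avoiding hSne hθ₂0 ?_ hES (hS.connects x y z w hxy hzw hd)
    rw [length_toList] at hE
    have h1 : (𝒞.card : ℝ) * k ≤ n := by
      have : 𝒞.card * (3 * k + 2) ≤ Fintype.card V := hbU ▸ card_le_univ _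
      have : 𝒞.card * k ≤ Fintype.card V := le_trans (Nat.mul_le_mul_left _ (by omega)) this
      rw [hn]; exact_mod_cast this
    have h2 : (E.card : ℝ) ≤ 𝒞.card * t := by exact_mod_cast hE
    rw [div_le_iff₀ (by positivity)] at hkt
    have h3 : 4 * (t : ℝ) * E.card ≤ 4 * (t : ℝ) * (𝒞.card * t) :=
      mul_le_mul_of_nonneg_left h2 (by positivity)
    have h4 : (𝒞.card : ℝ) * (8 * (t : ℝ) ^ 2) ≤ 𝒞.card * (k * (θ₂ * θ ^ 2)) :=
      mul_le_mul_of_nonneg_left hkt (by positivity)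
    have h5 : (𝒞.card : ℝ) * k * (θ₂ * θ ^ 2) ≤ n * (θ₂ * θ ^ 2) :=
      mul_le_mul_of_nonneg_right h1 (by positivity)
    have h6 : θ₂ * (θ ^ 2 / 2 * n) ≤ θ₂ * S.card := mul_le_mul_of_nonneg_left hScard' hθ₂0.le
    linarith
  have hmem : ∀ c, c ∈ 𝒞.toList → c ∈ 𝒞 := fun c => mem_toList.1
  obtain ⟨C, hC, hPC, hall⟩ := TightHam.exists_tightCycle_through hcon 𝒞.toList h𝒞ne P hP.tightPath
    hP.avoids (fun x y h => hmono x y (hP.connectable_end x y h))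
    (fun x y h => hmono x y (hP.connectable_start x y h))
    (fun c hc => by
      have := h𝒞.isGood c (hmem c hc)
      exact ⟨this.tightPath, this.start, this.finish, fun v hv => (this.avoids v hv).1,
        fun v hv hv' => (this.avoids v hv').2 hv⟩)
    (𝒞.nodup_toList.pairwise_of_forall_ne fun a ha b hb hab =>
      List.disjoint_toFinset_iff_disjoint.1 (h𝒞.disj (hmem a ha) (hmem b hb) hab)) le_rfl
  refine ⟨C, hC, hPC, ?_⟩
  have hsub : P.toFinset ∪ 𝒞.biUnion List.toFinset ⊆ C.toFinset := by
    intro v hv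
    rw [List.mem_toFinset]
    rcases mem_union.1 hv with h | h
    · exact hPC.subset (List.mem_toFinset.1 h)
    · obtain ⟨c, hc, hv⟩ := mem_biUnion.1 h
      exact hall c (mem_toList.2 hc) v (List.mem_toFinset.1 hv)
  have hfin : ((P.toFinset ∪ 𝒞.biUnion List.toFinset).card : ℝ) ≤ C.length := by
    exact_mod_cast (card_le_card hsub).trans C.toFinset_card_le
  rw [← hn]
  linarith
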